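/- For a finite positive Borel measure $\mu$ on the unit circle $\partial\mathbb D$, let $$S_\mu(z)=\exp\Bigl(-\int_{\partial\mathbb D}\frac{\zeta+z}{\zeta-z}\,d\mu(\zeta)\Bigr),\qquad |z|<1.$$ For $p>0$, let $H^p$ be the space of holomorphic functions $f$ on the unit disk with $\sup_{0\le r<1}\frac1{2\pi}\int_0^{2\pi}|f(re^{i\theta})|^p\,d\theta<\infty$. The complementary arcs of a closed set $E\subset\partial\mathbb D$ are the connected components $J$ of $\partial\mathbb D\setminus E$, and $|J|$ denotes the length of $J$. **Theorem.** Fix $0<p<1/2$. (i) Let $E\subset\partial\mathbb D$ be a closed set of zero length whose complementary arcs satisfy $\sum_J|J|^{1-q}<\infty$ for some real $q>\frac{p}{1-p}$, and let $\mu$ be a finite positive Borel measure on $\partial\mathbb D$ supported on $E$. Then $S_\mu'\in H^p$. (ii) The exponent $\frac p{1-p}$ in (i) is sharp: there exist a closed set $E\subset\partial\mathbb D$ of zero length whose complementary arcs satisfy $\sum_J|J|^{1-\frac p{1-p}}<\infty$ and a finite positive Borel measure $\mu$ on $\partial\mathbb D$ supported on $E$ such that $S_\mu'\notin H^p$. 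-/

import Mathlib

open MeasureTheory

noncomputable section

/-- The Borel σ-algebra on the unit circle. -/
instance : MeasurableSpace Circle := borel Circle

instance : BorelSpace Circle := ⟨rfl⟩

/-- Arc length on the unit circle, of total mass `2π`. -/
def arcLength : Measure Circle :=
  (volume.restrict (Set.Ioc (-Real.pi) Real.pi)).map Circle.exp

/-- The complementary arcs of `E`: the connected components of the complement of `E` in the
unit circle. -/
def complementaryArcs (E : Set Circle) : Set (Set Circle) :=
  {J | ∃ x ∈ Eᶜ, J = connectedComponentIn Eᶜ x}

/-- `E` is a closed subset of the unit circle of zero length whose complementary arcs `J` satisfy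
`∑ |J| ^ α < ∞`. -/
structure IsBeurlingCarleson (α : ℝ) (E : Set Circle) : Prop where
  isClosed : IsClosed E
  length_eq_zero : arcLength E = 0
  summable : Summable fun J : complementaryArcs E => arcLength.real (J : Set Circle) ^ α

/-- The function `S_μ(z) = exp (-∫ (ζ + z) / (ζ - z) dμ(ζ))` on the unit disk. -/
def singularInner (μ : Measure Circle) (z : ℂ) : ℂ :=
  Complex.exp (-∫ ζ : Circle, ((ζ : ℂ) + z) / ((ζ : ℂ) - z) ∂μ)

/-- The Hardy space `H^p` of the unit disk: holomorphic functions on the disk whose means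
`(1 / 2π) ∫ |f(r e^{iθ})|^p dθ` are bounded for `0 ≤ r < 1`. -/
def MemHardy (p : ℝ) (f : ℂ → ℂ) : Prop :=
  DifferentiableOn ℂ f (Metric.ball 0 1) ∧
    ∃ C : ℝ, ∀ r ∈ Set.Ico (0 : ℝ) 1, Real.circleAverage (fun z => ‖f z‖ ^ p) 0 r ≤ C

end

/-!
Throughout, `F(ξ) = ∫ dμ(ζ) / |ζ - ξ|²` (`inverseSquareIntegral`). Since `|S_μ| ≤ 1` and
`|ζ - ξ| ≤ 2 |ζ - r ξ|`, one has `|S_μ'(r ξ)| ≤ 8 F(ξ)` for all `0 ≤ r < 1`; conversely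
`|S_μ'(r ξ)| → 2 F(ξ)` as `r → 1` at each point `ξ` outside a closed set carrying `μ`. When `μ` is
carried by a closed set of zero length, Fatou's lemma therefore shows that `S_μ' ∈ H^p` if and only
if `F ∈ L^p` of the circle.

*Sufficiency.* Let `δ(ξ)` be the distance from `ξ` to `E`. On an arc `J` complementary to `E`, `δ`
is at least proportional to the distance to the end points of `J`, so for `0 < q < 1` the integral of
`δ ^ (-q)` over the circle is at most a multiple of `∑ |J| ^ (1 - q)`. Lowering `q` if necessary,
write `q = p u / (1 - p)` with `1 < u < 2`. By Hölder's inequality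
`∫ F ^ p = ∫ (F δ ^ u) ^ p δ ^ (-p u) ≤ (∫ F δ ^ u) ^ p (∫ δ ^ (-q)) ^ (1 - p)`,
and `∫ F δ ^ u` is finite by Tonelli's theorem: `δ(ξ) ≤ |ζ - ξ|` for `ζ ∈ E`, and
`|ζ - ξ| ^ (u - 2)` has an integral in `ξ` which does not depend on `ζ`. The two factors are
`lintegral_inverseSquareIntegral_mul_lt_top` and `IsBeurlingCarleson.lintegral_infEDist_lt_top`.

*Sharpness.* Equality in Hölder's inequality suggests a Cantor-type set. Attach to the midpoint of
each of the `2 ^ n` dyadic intervals of generation `n` in `(0, 1)` a jump of size `f n`, a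
multiple of `2 ^ (-n (1 - p) / (1 - 2 p)) (n + 1) ^ (-1 / (1 - 2 p))`, and let
`Φ(x) = -π + ∑ (jumps at points < x)`, normalised so that the jumps add up to `2π`. The jumps of `Φ`
skip disjoint open intervals filling `(-π, π)` up to a null set; `E` is the complement of their
images on the circle, and `μ` is the image of Lebesgue measure under `x ↦ exp (i Φ(x))`. The sizes
decay geometrically faster than `2 ^ (-n)`, so the points of `E` that come from the half of the
dyadic interval to the left of the midpoint are at distance `O(f n)` from the gap
(`gapCDF_dyadic_sub_le`), and `F ≥ c 2 ^ (-n) (f n) ^ (-2)` on the gap. Summing over the gaps of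
generation `n`, `∑ |J| ^ (1 - p / (1 - p))` receives a multiple of `(n + 1) ^ (-1 / (1 - p))`, which
is summable, whereas `∫ F ^ p` receives at least a multiple of `1 / (n + 1)`, which is not.
-/

open Set Filter Topology Metric
open scoped ENNReal NNReal

/-! ### The derivative of `S_μ` -/

lemma one_sub_norm_le_norm_coe_sub (z : ℂ) (ζ : Circle) : 1 - ‖z‖ ≤ ‖(ζ : ℂ) - z‖ := by
  have := norm_sub_norm_le (ζ : ℂ) z
  rwa [ζ.norm_coe] at this

lemma norm_coe_sub_le_two_mul {r : ℝ} (hr0 : 0 ≤ r) (hr1 : r ≤ 1) (ζ ξ : Circle) :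
    ‖(ζ : ℂ) - ξ‖ ≤ 2 * ‖(ζ : ℂ) - r * ξ‖ := by
  have h1 : ‖(r * ξ : ℂ)‖ = r := by simp [ξ.norm_coe, abs_of_nonneg hr0]
  have h2 := one_sub_norm_le_norm_coe_sub (r * ξ : ℂ) ζ
  have h3 : ‖(r * ξ : ℂ) - ξ‖ = 1 - r := by
    rw [show (r * ξ : ℂ) - ξ = ((r - 1 : ℝ) : ℂ) * ξ by push_cast; ring, norm_mul, ξ.norm_coe,
      Complex.norm_real, Real.norm_eq_abs, abs_of_nonpos (by linarith)]
    ring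
  have h4 := norm_sub_le_norm_sub_add_norm_sub (ζ : ℂ) (r * ξ) ξ
  linarith

lemma measurable_circle_coe : Measurable fun ζ : Circle => (ζ : ℂ) :=
  (show Continuous fun ζ : Circle => (ζ : ℂ) from continuous_subtype_val).measurable

lemma measurable_herglotz_kernel (z : ℂ) :
    Measurable fun ζ : Circle => ((ζ : ℂ) + z) / ((ζ : ℂ) - z) :=
  (measurable_circle_coe.add_const z).div (measurable_circle_coe.sub_const z)

lemma measurable_deriv_herglotz_kernel (z : ℂ) :
    Measurable fun ζ : Circle => 2 * (ζ : ℂ) / ((ζ : ℂ) - z) ^ 2 :=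
  (measurable_circle_coe.const_mul 2).div ((measurable_circle_coe.sub_const z).pow_const 2)

/-- The Herglotz integral may be differentiated under the integral sign. -/
lemma hasDerivAt_herglotz (μ : Measure Circle) [IsFiniteMeasure μ] {z : ℂ} (hz : ‖z‖ < 1) :
    HasDerivAt (fun w => ∫ ζ : Circle, ((ζ : ℂ) + w) / ((ζ : ℂ) - w) ∂μ)
      (∫ ζ : Circle, 2 * (ζ : ℂ) / ((ζ : ℂ) - z) ^ 2 ∂μ) z := by
  have hε : 0 < (1 - ‖z‖) / 2 := by linarith
  have hball : ∀ w ∈ ball z ((1 - ‖z‖) / 2), ‖w‖ ≤ (1 + ‖z‖) / 2 := fun w hw => by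
    have := norm_le_norm_add_norm_sub' w z
    rw [mem_ball, dist_eq_norm] at hw
    linarith
  have hm := measurable_circle_coe
  have hdist : ∀ w ∈ ball z ((1 - ‖z‖) / 2), ∀ ζ : Circle, (1 - ‖z‖) / 2 ≤ ‖(ζ : ℂ) - w‖ :=
    fun w hw ζ => by linarith [hball w hw, one_sub_norm_le_norm_coe_sub w ζ]
  refine (hasDerivAt_integral_of_dominated_loc_of_deriv_le (μ := μ)
    (bound := fun _ => 2 / ((1 - ‖z‖) / 2) ^ 2)
    (F' := fun w ζ => 2 * (ζ : ℂ) / ((ζ : ℂ) - w) ^ 2) (ball_mem_nhds z hε) ?_ ?_ ?_ ?_ ?_ ?_).2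
  · exact .of_forall fun w => (measurable_herglotz_kernel _).aestronglyMeasurable
  · refine (integrable_const (2 / ((1 - ‖z‖) / 2))).mono'
      (measurable_herglotz_kernel _).aestronglyMeasurable (.of_forall fun ζ => ?_)
    rw [norm_div]
    have h := hdist z (mem_ball_self hε) ζ
    have : ‖(ζ : ℂ) + z‖ ≤ 2 := (norm_add_le _ _).trans (by rw [ζ.norm_coe]; linarith)
    gcongr
  · exact (measurable_deriv_herglotz_kernel _).aestronglyMeasurable
  · refine .of_forall fun ζ w hw => ?_
    rw [norm_div, norm_mul, ζ.norm_coe, norm_pow]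
    have h := hdist w hw ζ
    simp only [Complex.norm_ofNat, mul_one]
    gcongr
  · exact integrable_const _
  · refine .of_forall fun ζ w hw => ?_
    have h0 : (ζ : ℂ) - w ≠ 0 := norm_pos_iff.1 (hε.trans_le (hdist w hw ζ))
    refine (((hasDerivAt_id w).const_add (ζ : ℂ)).div
      ((hasDerivAt_id w).const_sub (ζ : ℂ)) h0).congr_deriv ?_
    simp only [id]
    congr 1
    ring

lemma hasDerivAt_singularInner (μ : Measure Circle) [IsFiniteMeasure μ] {z : ℂ} (hz : ‖z‖ < 1) :
    HasDerivAt (singularInner μ)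
      (singularInner μ z * -∫ ζ : Circle, 2 * (ζ : ℂ) / ((ζ : ℂ) - z) ^ 2 ∂μ) z :=
  (hasDerivAt_herglotz μ hz).neg.cexp

lemma differentiableOn_deriv_singularInner (μ : Measure Circle) [IsFiniteMeasure μ] :
    DifferentiableOn ℂ (deriv (singularInner μ)) (ball 0 1) := by
  refine DifferentiableOn.deriv (fun z hz => ?_) isOpen_ball
  have h := hasDerivAt_singularInner μ (mem_ball_zero_iff.1 hz)
  exact h.differentiableAt.differentiableWithinAt

lemma herglotz_kernel_re (ζ : Circle) (z : ℂ) :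
    (((ζ : ℂ) + z) / ((ζ : ℂ) - z)).re = (1 - ‖z‖ ^ 2) / ‖(ζ : ℂ) - z‖ ^ 2 := by
  have h : Complex.normSq (ζ : ℂ) = 1 := ζ.normSq_coe
  rw [Complex.div_re, ← Complex.normSq_eq_norm_sq, ← Complex.normSq_eq_norm_sq, ← add_div, ← h]
  congr 1
  simp only [Complex.normSq_apply, Complex.add_re, Complex.sub_re, Complex.add_im, Complex.sub_im]
  ring

lemma norm_singularInner_le_one (μ : Measure Circle) [IsFiniteMeasure μ] {z : ℂ} (hz : ‖z‖ < 1) :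
    ‖singularInner μ z‖ ≤ 1 := by
  rw [singularInner, Complex.norm_exp, Real.exp_le_one_iff, Complex.neg_re, neg_nonpos]
  by_cases hi : Integrable (fun ζ : Circle => ((ζ : ℂ) + z) / ((ζ : ℂ) - z)) μ
  · have := integral_re hi
    simp only [RCLike.re_eq_complex_re] at this
    rw [← this]
    refine integral_nonneg fun ζ => ?_
    simp only [Pi.zero_apply]
    rw [herglotz_kernel_re]
    have : ‖z‖ ^ 2 ≤ 1 := pow_le_one₀ (norm_nonneg _) hz.le
    exact div_nonneg (by linarith) (by positivity)
  · rw [integral_undef hi]; simp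

/-- The integral `∫ dμ(ζ) / |ζ - ξ|²` at a point `ξ` of the circle, as an extended nonnegative
number. Off the support of `μ`, twice this integral is `|S_μ'(ξ)|`. -/
noncomputable def inverseSquareIntegral (μ : Measure Circle) (ξ : Circle) : ℝ≥0∞ :=
  ∫⁻ ζ : Circle, (edist ξ ζ ^ 2)⁻¹ ∂μ

lemma edist_circle_eq (ξ ζ : Circle) : edist ξ ζ = ENNReal.ofReal ‖(ζ : ℂ) - ξ‖ := by
  rw [edist_dist, dist_comm]; congr 1; exact dist_eq_norm (ζ : ℂ) ξ

lemma measurable_inverseSquareIntegral (μ : Measure Circle) [IsFiniteMeasure μ] :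
    Measurable (inverseSquareIntegral μ) := by
  refine Measurable.lintegral_prod_right' (f := fun x : Circle × Circle => (edist x.1 x.2 ^ 2)⁻¹) ?_
  exact ((measurable_fst.edist measurable_snd).pow_const 2).inv

/-- The radial bound `|S_μ'(rξ)| ≤ 8 ∫ dμ(ζ) / |ζ - ξ|²`, uniform in `r`. -/
lemma enorm_deriv_singularInner_le (μ : Measure Circle) [IsFiniteMeasure μ] {r : ℝ}
    (hr0 : 0 ≤ r) (hr1 : r < 1) (ξ : Circle) :
    ‖deriv (singularInner μ) (r * ξ)‖ₑ ≤ 8 * inverseSquareIntegral μ ξ := by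
  have hz : ‖(r * ξ : ℂ)‖ < 1 := by simpa [ξ.norm_coe, abs_of_nonneg hr0] using hr1
  rw [(hasDerivAt_singularInner μ hz).deriv, enorm_mul, enorm_neg, inverseSquareIntegral,
    ← lintegral_const_mul' _ _ (by simp)]
  have h1 : ‖singularInner μ (r * ξ)‖ₑ ≤ 1 := by
    rw [← ofReal_norm, ENNReal.ofReal_le_one]
    exact norm_singularInner_le_one μ hz
  refine (mul_le_mul' h1 (enorm_integral_le_lintegral_enorm _)).trans ?_
  rw [one_mul]
  refine lintegral_mono fun ζ => ?_
  rcases eq_or_ne ζ ξ with rfl | hne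
  · simp
  have h0 : 0 < ‖(ζ : ℂ) - ξ‖ := norm_pos_iff.2 (sub_ne_zero.2 fun h => hne (Circle.ext h))
  rw [edist_circle_eq, ← ENNReal.ofReal_pow h0.le, ← ENNReal.ofReal_inv_of_pos (by positivity),
    show (8 : ℝ≥0∞) = ENNReal.ofReal 8 by simp, ← ENNReal.ofReal_mul (by norm_num), ← ofReal_norm]
  refine ENNReal.ofReal_le_ofReal ?_
  have h2 := norm_coe_sub_le_two_mul hr0 hr1.le ζ ξ
  rw [norm_div, norm_mul, ζ.norm_coe, norm_pow, Complex.norm_ofNat, mul_one, ← div_eq_mul_inv,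
    div_le_div_iff₀ (by nlinarith) (by positivity)]
  nlinarith

lemma tendsto_ofReal_mul_circle (ξ : Circle) :
    Tendsto (fun r : ℝ => (r : ℂ) * ξ) (𝓝[<] 1) (𝓝 (ξ : ℂ)) := by
  have : Continuous fun r : ℝ => (r : ℂ) * ξ := by fun_prop
  simpa using (this.tendsto 1).mono_left nhdsWithin_le_nhds

lemma eventually_mem_Ico_nhdsLT_one : ∀ᶠ r : ℝ in 𝓝[<] 1, r ∈ Ico (0 : ℝ) 1 :=
  mem_of_superset (Ioo_mem_nhdsLT zero_lt_one) Ioo_subset_Ico_self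

/-- Off a closed set carrying `μ`, the radial limit of `|S_μ'|` is `2 ∫ dμ(ζ) / |ζ - ξ|²`: the
Herglotz integral is purely imaginary there, and the kernels `2ζ / (ζ - ξ)²` all have the same
argument. -/
lemma tendsto_enorm_deriv_singularInner (μ : Measure Circle) [IsFiniteMeasure μ] {E : Set Circle}
    (hE : IsClosed E) (hμ : μ Eᶜ = 0) {ξ : Circle} (hξ : ξ ∉ E) :
    Tendsto (fun r : ℝ => ‖deriv (singularInner μ) (r * ξ)‖ₑ) (𝓝[<] 1)
      (𝓝 (2 * inverseSquareIntegral μ ξ)) := by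
  obtain ⟨δ, hδ, hball⟩ := Metric.isOpen_iff.1 hE.isOpen_compl ξ hξ
  have hm := measurable_circle_coe
  have hae : ∀ᵐ ζ : Circle ∂μ, δ ≤ ‖(ζ : ℂ) - ξ‖ := by
    filter_upwards [show ∀ᵐ ζ ∂μ, ζ ∈ E from hμ] with ζ hζ
    by_contra! hlt
    exact hball (show dist (ζ : ℂ) ξ < δ by rwa [dist_eq_norm]) hζ
  have hae2 : ∀ᶠ r : ℝ in 𝓝[<] 1, ∀ᵐ ζ : Circle ∂μ, δ / 2 ≤ ‖(ζ : ℂ) - r * ξ‖ := by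
    filter_upwards [eventually_mem_Ico_nhdsLT_one] with r hr
    filter_upwards [hae] with ζ hζ
    linarith [norm_coe_sub_le_two_mul hr.1 hr.2.le ζ ξ]
  have hnorm : ∀ r ∈ Ico (0 : ℝ) 1, ‖(r * ξ : ℂ)‖ < 1 := fun r hr => by
    simpa [ξ.norm_coe, abs_of_nonneg hr.1] using hr.2
  have hA : Tendsto (fun r : ℝ => ∫ ζ : Circle, ((ζ : ℂ) + r * ξ) / ((ζ : ℂ) - r * ξ) ∂μ) (𝓝[<] 1)
      (𝓝 (∫ ζ : Circle, ((ζ : ℂ) + ξ) / ((ζ : ℂ) - ξ) ∂μ)) := by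
    refine tendsto_integral_filter_of_dominated_convergence (fun _ => 2 / (δ / 2))
      (.of_forall fun r => (measurable_herglotz_kernel _).aestronglyMeasurable) ?_
      (integrable_const _) ?_
    · filter_upwards [hae2, eventually_mem_Ico_nhdsLT_one] with r h2 hr
      filter_upwards [h2] with ζ hζ
      rw [norm_div]
      have : ‖(ζ : ℂ) + r * ξ‖ ≤ 2 :=
        (norm_add_le _ _).trans (by rw [ζ.norm_coe]; linarith [hnorm r hr])
      gcongr
    · filter_upwards [hae] with ζ hζ
      have hne : (ζ : ℂ) - ξ ≠ 0 := norm_pos_iff.1 (hδ.trans_le hζ)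
      exact (tendsto_const_nhds.add (tendsto_ofReal_mul_circle ξ)).div
        (tendsto_const_nhds.sub (tendsto_ofReal_mul_circle ξ)) hne
  have hB : Tendsto (fun r : ℝ => ∫ ζ : Circle, 2 * (ζ : ℂ) / ((ζ : ℂ) - r * ξ) ^ 2 ∂μ) (𝓝[<] 1)
      (𝓝 (∫ ζ : Circle, 2 * (ζ : ℂ) / ((ζ : ℂ) - ξ) ^ 2 ∂μ)) := by
    refine tendsto_integral_filter_of_dominated_convergence (fun _ => 2 / (δ / 2) ^ 2)
      (.of_forall fun r => (measurable_deriv_herglotz_kernel _).aestronglyMeasurable) ?_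
      (integrable_const _) ?_
    · filter_upwards [hae2] with r h2
      filter_upwards [h2] with ζ hζ
      rw [norm_div, norm_mul, ζ.norm_coe, norm_pow, Complex.norm_ofNat, mul_one]
      gcongr
    · filter_upwards [hae] with ζ hζ
      have hne : (ζ : ℂ) - ξ ≠ 0 := norm_pos_iff.1 (hδ.trans_le hζ)
      exact tendsto_const_nhds.div
        ((tendsto_const_nhds.sub (tendsto_ofReal_mul_circle ξ)).pow 2) (pow_ne_zero 2 hne)
  have hA1 : ‖Complex.exp (-∫ ζ : Circle, ((ζ : ℂ) + ξ) / ((ζ : ℂ) - ξ) ∂μ)‖ = 1 := by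
    rw [Complex.norm_exp, Real.exp_eq_one_iff, Complex.neg_re, neg_eq_zero]
    have hi : Integrable (fun ζ : Circle => ((ζ : ℂ) + ξ) / ((ζ : ℂ) - ξ)) μ := by
      refine (integrable_const (2 / δ)).mono'
        (measurable_herglotz_kernel _).aestronglyMeasurable ?_
      filter_upwards [hae] with ζ hζ
      rw [norm_div]
      have : ‖(ζ : ℂ) + ξ‖ ≤ 2 :=
        (norm_add_le _ _).trans (by rw [ζ.norm_coe, ξ.norm_coe]; norm_num)
      gcongr
    have := integral_re hi
    simp only [RCLike.re_eq_complex_re] at this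
    rw [← this]
    simp [herglotz_kernel_re, ξ.norm_coe]
  have hB1 : ‖∫ ζ : Circle, 2 * (ζ : ℂ) / ((ζ : ℂ) - ξ) ^ 2 ∂μ‖ₑ =
      2 * inverseSquareIntegral μ ξ := by
    -- On the circle `ζ ξ / (ζ - ξ)² = -1 / |ζ - ξ|²`.
    have hker : ∀ ζ : Circle, 2 * (ζ : ℂ) / ((ζ : ℂ) - ξ) ^ 2 =
        (-(ξ : ℂ)⁻¹) * ((2 * (‖(ζ : ℂ) - ξ‖ ^ 2)⁻¹ : ℝ) : ℂ) := fun ζ => by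
      rcases eq_or_ne (ζ : ℂ) ξ with h | h
      · simp [h]
      have hne := sub_ne_zero.2 h
      have hc : ((‖(ζ : ℂ) - ξ‖ ^ 2 : ℝ) : ℂ) = -((ζ : ℂ) - ξ) ^ 2 * ((ζ : ℂ)⁻¹ * (ξ : ℂ)⁻¹) := by
        rw [← Complex.normSq_eq_norm_sq, Complex.normSq_eq_conj_mul_self, map_sub,
          ← Circle.coe_inv_eq_conj, ← Circle.coe_inv_eq_conj, Circle.coe_inv, Circle.coe_inv]
        have h1 := ζ.coe_ne_zero
        have h2 := ξ.coe_ne_zero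
        field_simp
        ring
      rw [Complex.ofReal_mul, Complex.ofReal_inv, hc]
      have h1 := ζ.coe_ne_zero
      have h2 := ξ.coe_ne_zero
      push_cast
      field_simp
    simp_rw [hker]
    rw [integral_const_mul, enorm_mul, enorm_neg, integral_complex_ofReal, ← Circle.coe_inv,
      ← ofReal_norm ((ξ⁻¹ : Circle) : ℂ), Circle.norm_coe, ENNReal.ofReal_one, one_mul,
      ← ofReal_norm, Complex.norm_real,
      Real.norm_of_nonneg (integral_nonneg fun _ => by positivity),
      ofReal_integral_eq_lintegral_ofReal _ (.of_forall fun _ => by positivity),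
      inverseSquareIntegral, ← lintegral_const_mul' _ _ (by simp)]
    · refine lintegral_congr_ae ?_
      filter_upwards [hae] with ζ hζ
      have h0 : 0 < ‖(ζ : ℂ) - ξ‖ := hδ.trans_le hζ
      rw [edist_circle_eq, ← ENNReal.ofReal_pow h0.le, ← ENNReal.ofReal_inv_of_pos (by positivity),
        ENNReal.ofReal_mul (by norm_num)]
      simp
    · refine (integrable_const (2 * (δ ^ 2)⁻¹)).mono' (by fun_prop) ?_
      filter_upwards [hae] with ζ hζ
      rw [Real.norm_of_nonneg (by positivity)]
      gcongr
  have hlim := (((Complex.continuous_exp.tendsto _).comp hA.neg).mul hB.neg).enorm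
  rw [enorm_mul, enorm_neg, hB1, ← ofReal_norm, hA1, ENNReal.ofReal_one, one_mul] at hlim
  refine hlim.congr' ?_
  filter_upwards [eventually_mem_Ico_nhdsLT_one] with r hr
  rw [(hasDerivAt_singularInner μ (hnorm r hr)).deriv]
  rfl

/-! ### Distance to a closed set and its complementary arcs -/

/-- A point outside the arc `exp '' (α, β)` keeps a distance from `exp t` which is at least
proportional to the distance from `t` to the end points of `(α, β)`. -/
lemma two_div_pi_mul_min_le_dist {α β t : ℝ} {ζ : Circle} (hζ : ζ ∉ Circle.exp '' Ioo α β) :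
    2 / Real.pi * min (t - α) (β - t) ≤ dist (Circle.exp t) ζ := by
  -- `u` is the angle from `exp t` to `ζ`, chosen in `(-π, π]`.
  set u : ℝ := Complex.arg (ζ / Circle.exp t : Circle)
  have hexp : Circle.exp u = ζ / Circle.exp t := Circle.exp_arg _
  have hζu : Circle.exp (t + u) = ζ := by rw [Circle.exp_add, hexp, mul_div_cancel]
  have hmin : min (t - α) (β - t) ≤ |u| := by
    by_contra! h
    rw [lt_min_iff] at h
    exact hζ ⟨t + u, ⟨by linarith [neg_abs_le u], by linarith [le_abs_self u]⟩, hζu⟩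
  have habs : |u / 2| ≤ Real.pi / 2 := by
    rw [abs_div, abs_two]
    exact div_le_div_of_nonneg_right (Complex.abs_arg_le_pi _) zero_le_two
  have hdist : dist (Circle.exp t) ζ = 2 * |Real.sin (u / 2)| := by
    have h1 : dist (Circle.exp t) ζ = ‖(ζ : ℂ) - Circle.exp t‖ := by
      rw [dist_comm]; exact dist_eq_norm (ζ : ℂ) (Circle.exp t)
    have h2 : (ζ : ℂ) - Circle.exp t = Circle.exp t * (Complex.exp (Complex.I * u) - 1) := by
      rw [mul_comm Complex.I, ← Circle.coe_exp, hexp, ← Circle.coe_one, mul_sub, ← Circle.coe_mul,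
        mul_div_cancel, Circle.coe_one, mul_one]
    rw [h1, h2, norm_mul, Circle.norm_coe, one_mul, Complex.norm_exp_I_mul_ofReal_sub_one,
      norm_mul, Real.norm_eq_abs, Real.norm_eq_abs, abs_two]
  have hsin := Real.mul_abs_le_abs_sin habs
  rw [abs_div, abs_two] at hsin
  rw [hdist]
  calc 2 / Real.pi * min (t - α) (β - t) ≤ 2 / Real.pi * |u| := by gcongr
    _ = 2 * (2 / Real.pi * (|u| / 2)) := by ring
    _ ≤ _ := by gcongr

/-- The constant in the estimate `∫ d(exp t, K) ^ (-q) ≤ C (β - α) ^ (1 - q)` over an arc. -/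
noncomputable def arcConst (q : ℝ) : ℝ := (2 / Real.pi) ^ (-q) * (2 / (1 - q))

lemma lintegral_infEDist_rpow_le {q α β : ℝ} (hq0 : 0 < q) (hq1 : q < 1) (hαβ : α ≤ β)
    {K : Set Circle} (hK : Disjoint K (Circle.exp '' Ioo α β)) :
    ∫⁻ t in Ioo α β, infEDist (Circle.exp t) K ^ (-q) ≤
      ENNReal.ofReal (arcConst q * (β - α) ^ (1 - q)) := by
  set c : ℝ := (2 / Real.pi) ^ (-q) with hc
  have hπ : 0 < 2 / Real.pi := div_pos two_pos Real.pi_pos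
  have hc0 : 0 < c := Real.rpow_pos_of_pos hπ _
  have hpt : ∀ t ∈ Ioo α β, infEDist (Circle.exp t) K ^ (-q) ≤
      ENNReal.ofReal (c * ((t - α) ^ (-q) + (β - t) ^ (-q))) := by
    intro t ht
    have h1 : 0 < t - α := sub_pos.2 ht.1
    have h2 : 0 < β - t := sub_pos.2 ht.2
    have hm : 0 < min (t - α) (β - t) := lt_min h1 h2
    have hle : ENNReal.ofReal (2 / Real.pi * min (t - α) (β - t)) ≤ infEDist (Circle.exp t) K := by
      rw [le_infEDist]
      intro y hy
      rw [edist_dist]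
      exact ENNReal.ofReal_le_ofReal
        (two_div_pi_mul_min_le_dist fun h => disjoint_left.1 hK hy h)
    calc infEDist (Circle.exp t) K ^ (-q)
        ≤ ENNReal.ofReal (2 / Real.pi * min (t - α) (β - t)) ^ (-q) := by
          rw [ENNReal.rpow_neg, ENNReal.rpow_neg]
          exact ENNReal.inv_le_inv.2 (ENNReal.rpow_le_rpow hle hq0.le)
      _ = ENNReal.ofReal (c * min (t - α) (β - t) ^ (-q)) := by
          rw [ENNReal.ofReal_rpow_of_pos (mul_pos hπ hm), Real.mul_rpow hπ.le hm.le]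
      _ ≤ _ := by
          refine ENNReal.ofReal_le_ofReal (mul_le_mul_of_nonneg_left ?_ hc0.le)
          have h3 := Real.rpow_nonneg h1.le (-q)
          have h4 := Real.rpow_nonneg h2.le (-q)
          rcases min_choice (t - α) (β - t) with h | h <;> rw [h] <;> linarith
  have hI1 : IntervalIntegrable (fun t => (t - α) ^ (-q)) volume α β := by
    have := (intervalIntegral.intervalIntegrable_rpow' (a := 0) (b := β - α)
      (by linarith : -1 < -q)).comp_sub_right α
    simpa using this
  have hI2 : IntervalIntegrable (fun t => (β - t) ^ (-q)) volume α β := by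
    have := (intervalIntegral.intervalIntegrable_rpow' (a := β - α) (b := 0)
      (by linarith : -1 < -q)).comp_sub_left β
    simpa using this
  have hv1 : ∫ t in α..β, (t - α) ^ (-q) = (β - α) ^ (1 - q) / (1 - q) := by
    rw [intervalIntegral.integral_comp_sub_right (fun x => x ^ (-q)) α,
      integral_rpow (Or.inl (by linarith)), sub_self, Real.zero_rpow (by linarith)]
    ring_nf
  have hv2 : ∫ t in α..β, (β - t) ^ (-q) = (β - α) ^ (1 - q) / (1 - q) := by
    rw [intervalIntegral.integral_comp_sub_left (fun x => x ^ (-q)) β,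
      integral_rpow (Or.inl (by linarith)), sub_self, Real.zero_rpow (by linarith)]
    ring_nf
  have hI : IntegrableOn (fun t => c * ((t - α) ^ (-q) + (β - t) ^ (-q))) (Ioo α β) :=
    (intervalIntegrable_iff_integrableOn_Ioo_of_le hαβ).1 ((hI1.add hI2).const_mul c)
  calc ∫⁻ t in Ioo α β, infEDist (Circle.exp t) K ^ (-q)
      ≤ ∫⁻ t in Ioo α β, ENNReal.ofReal (c * ((t - α) ^ (-q) + (β - t) ^ (-q))) :=
        setLIntegral_mono' measurableSet_Ioo hpt
    _ = ENNReal.ofReal (∫ t in Ioo α β, c * ((t - α) ^ (-q) + (β - t) ^ (-q))) := by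
        refine (ofReal_integral_eq_lintegral_ofReal hI ?_).symm
        filter_upwards [ae_restrict_mem measurableSet_Ioo] with t ht
        have h1 := Real.rpow_nonneg (sub_pos.2 ht.1).le (-q)
        have h2 := Real.rpow_nonneg (sub_pos.2 ht.2).le (-q)
        exact mul_nonneg hc0.le (add_nonneg h1 h2)
    _ = _ := by
        rw [← integral_Ioc_eq_integral_Ioo, ← intervalIntegral.integral_of_le hαβ,
          intervalIntegral.integral_const_mul, intervalIntegral.integral_add hI1 hI2, hv1, hv2,
          arcConst]
        congr 1
        ring

lemma arcConst_nonneg {q : ℝ} (hq1 : q < 1) : 0 ≤ arcConst q := by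
  have := Real.pi_pos
  have : 0 < 1 - q := by linarith
  unfold arcConst
  positivity

/-- Arc length may be computed on any half-open interval of length `2π`. -/
lemma arcLength_eq_map_restrict_Ioc (a : ℝ) :
    arcLength = (volume.restrict (Ioc a (a + 2 * Real.pi))).map Circle.exp := by
  have hexp : Measurable Circle.exp := Circle.exp.continuous.measurable
  ext S hS
  have h := (isAddFundamentalDomain_Ioc Real.two_pi_pos (-Real.pi)).measure_set_eq
    (isAddFundamentalDomain_Ioc Real.two_pi_pos a) (hexp hS) (by
      rintro ⟨g, k, rfl⟩
      ext x
      simp only [mem_preimage, AddSubgroup.vadd_def, vadd_eq_add, zsmul_eq_mul]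
      rw [Circle.exp_add, Circle.exp_int_mul_two_pi, one_mul])
  rw [arcLength, Measure.map_apply hexp hS, Measure.map_apply hexp hS,
    Measure.restrict_apply (hexp hS), Measure.restrict_apply (hexp hS), ← h]
  congr 3
  ring

instance : IsFiniteMeasure arcLength := by
  unfold arcLength
  infer_instance

lemma lintegral_arcLength (a : ℝ) {H : Circle → ℝ≥0∞} (hH : Measurable H) :
    ∫⁻ ξ, H ξ ∂arcLength = ∫⁻ t in Ioc a (a + 2 * Real.pi), H (Circle.exp t) := by
  rw [arcLength_eq_map_restrict_Ioc a, lintegral_map hH Circle.exp.continuous.measurable]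

/-- Negative powers of the distance to a point, of exponent less than `1`, have an integral
over the circle which does not depend on the point. -/
lemma lintegral_edist_rpow_le {q : ℝ} (hq0 : 0 < q) (hq1 : q < 1) (ζ : Circle) :
    ∫⁻ ξ, edist ξ ζ ^ (-q) ∂arcLength ≤
      ENNReal.ofReal (arcConst q * (2 * Real.pi) ^ (1 - q)) := by
  set a : ℝ := Complex.arg ζ
  have ha : Circle.exp a = ζ := Circle.exp_arg ζ
  rw [lintegral_arcLength a ((measurable_edist_left).pow_const (-q)),
    restrict_Ioo_eq_restrict_Ioc.symm]
  have hdisj : Disjoint {ζ} (Circle.exp '' Ioo a (a + 2 * Real.pi)) := by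
    rw [disjoint_singleton_left]
    rintro ⟨t, ht, h⟩
    have := Circle.exp_injOn_Ico (a := a) (b := a + 2 * Real.pi) (by linarith)
      ⟨ht.1.le, ht.2⟩ ⟨le_rfl, by linarith [Real.pi_pos]⟩ (h.trans ha.symm)
    exact ht.1.ne' this
  have := lintegral_infEDist_rpow_le hq0 hq1 (by linarith [Real.pi_pos]) hdisj
  simpa using this

lemma IsPreconnected.exists_Ioo_subset_subset_Icc {V : Set ℝ} (hV : IsPreconnected V)
    (hne : V.Nonempty) (hb : BddBelow V) (ha : BddAbove V) :
    ∃ α β, α ≤ β ∧ Ioo α β ⊆ V ∧ V ⊆ Icc α β :=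
  ⟨sInf V, sSup V, (csInf_le hb hne.some_mem).trans (le_csSup ha hne.some_mem),
    IsConnected.Ioo_csInf_csSup_subset ⟨hne, hV⟩ hb ha,
    fun _ hx => ⟨csInf_le hb hx, le_csSup ha hx⟩⟩

/-- The angles in `(a, a + 2π]` of a connected subset of the circle that misses `exp a` form a
connected set. -/
lemma isPreconnected_preimage_exp {a : ℝ} {J : Set Circle} (hJ : IsPreconnected J)
    (ha : Circle.exp a ∉ J) :
    IsPreconnected (Circle.exp ⁻¹' J ∩ Ioc a (a + 2 * Real.pi)) := by
  -- `ψ` is the inverse of `exp` on `(a, a + 2π)`.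
  set ψ : Circle → ℝ := fun ξ => a + Real.pi + Complex.arg (-(ξ / Circle.exp a) : Circle) with hψ
  have hexpψ : ∀ ξ, Circle.exp (ψ ξ) = ξ := fun ξ => by
    have hpi : Circle.exp Real.pi = -1 := Circle.ext (by simp [Circle.coe_exp])
    rw [hψ]
    simp only
    rw [Circle.exp_add, Circle.exp_arg, Circle.exp_add, hpi]
    simp
  have hmem : ∀ ξ, ψ ξ ∈ Ioc a (a + 2 * Real.pi) := fun ξ => by
    have h1 := Complex.neg_pi_lt_arg (-(ξ / Circle.exp a) : Circle)
    have h2 := Complex.arg_le_pi (-(ξ / Circle.exp a) : Circle)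
    constructor <;> simp only [hψ] <;> linarith
  have himg : Circle.exp ⁻¹' J ∩ Ioc a (a + 2 * Real.pi) = ψ '' J := by
    ext t
    constructor
    · rintro ⟨htJ, ht⟩
      exact ⟨Circle.exp t, htJ,
        Circle.exp_injOn_Ioc (by linarith) (hmem _) ht (hexpψ _)⟩
    · rintro ⟨ξ, hξ, rfl⟩
      exact ⟨by rwa [mem_preimage, hexpψ], hmem ξ⟩
  rw [himg]
  refine hJ.image ψ fun ξ hξ => ContinuousAt.continuousWithinAt ?_
  have hslit : ((-(ξ / Circle.exp a) : Circle) : ℂ) ∈ Complex.slitPlane := by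
    rw [Complex.mem_slitPlane_iff_arg]
    refine ⟨fun h => ?_, Circle.coe_ne_zero _⟩
    have h1 : ψ ξ = a + 2 * Real.pi := by simp only [hψ, h]; ring
    have h2 := hexpψ ξ
    rw [h1, Circle.exp_add_two_pi] at h2
    exact ha (h2 ▸ hξ)
  have hcont : Continuous fun ξ : Circle => ((-(ξ / Circle.exp a) : Circle) : ℂ) :=
    continuous_subtype_val.comp (by fun_prop : Continuous fun ξ : Circle => -(ξ / Circle.exp a))
  exact continuousAt_const.add
    (ContinuousAt.comp (f := fun ξ : Circle => ((-(ξ / Circle.exp a) : Circle) : ℂ))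
      (Complex.continuousAt_arg hslit) hcont.continuousAt)

lemma isOpen_of_mem_complementaryArcs {E : Set Circle} (hE : IsClosed E) {J : Set Circle}
    (hJ : J ∈ complementaryArcs E) : IsOpen J := by
  have := ChartedSpace.locallyConnectedSpace (EuclideanSpace ℝ (Fin 1)) Circle
  obtain ⟨x, -, rfl⟩ := hJ
  exact hE.isOpen_compl.connectedComponentIn

lemma countable_complementaryArcs {E : Set Circle} (hE : IsClosed E) :
    (complementaryArcs E).Countable := by
  refine PairwiseDisjoint.countable_of_isOpen (s := id) (fun J hJ J' hJ' hne => ?_)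
    (fun J hJ => isOpen_of_mem_complementaryArcs hE hJ) fun J hJ => ?_
  · obtain ⟨x, -, rfl⟩ := hJ
    obtain ⟨y, -, rfl⟩ := hJ'
    by_contra h
    obtain ⟨z, hz1, hz2⟩ := not_disjoint_iff.1 h
    exact hne ((connectedComponentIn_eq hz1).trans (connectedComponentIn_eq hz2).symm)
  · obtain ⟨x, hx, rfl⟩ := hJ
    exact ⟨x, mem_connectedComponentIn hx⟩

/-- The angles of an arc complementary to `E`, measured from a point of `E`, form an interval whose
length is that of the arc. -/
lemma setLIntegral_infEDist_complementaryArc_le {q : ℝ} (hq0 : 0 < q) (hq1 : q < 1)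
    {E : Set Circle} (hE : IsClosed E) (hne : E.Nonempty) {J : Set Circle}
    (hJ : J ∈ complementaryArcs E) :
    ∫⁻ ξ in J, infEDist ξ E ^ (-q) ∂arcLength ≤
      ENNReal.ofReal (arcConst q * arcLength.real J ^ (1 - q)) := by
  have hJo := isOpen_of_mem_complementaryArcs hE hJ
  have hexp : Measurable Circle.exp := Circle.exp.continuous.measurable
  obtain ⟨x, hx, rfl⟩ := hJ
  set J := connectedComponentIn Eᶜ x
  have hJE : J ⊆ Eᶜ := connectedComponentIn_subset _ _
  obtain ⟨e, he⟩ := hne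
  set a : ℝ := Complex.arg e
  have ha : Circle.exp a = e := Circle.exp_arg e
  have hV := isPreconnected_preimage_exp (a := a) isPreconnected_connectedComponentIn
    (fun h => hJE h (ha ▸ he) : Circle.exp a ∉ J)
  set V := Circle.exp ⁻¹' J ∩ Ioc a (a + 2 * Real.pi)
  have hVne : V.Nonempty := by
    obtain ⟨t, ht, hxt⟩ : x ∈ Circle.exp '' Ioc a (a + 2 * Real.pi) := by
      have := Circle.periodic_exp.image_Ioc Real.two_pi_pos a
      rw [this]
      exact ⟨Complex.arg x, Circle.exp_arg x⟩
    exact ⟨t, by rw [mem_preimage, hxt]; exact mem_connectedComponentIn hx, ht⟩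
  obtain ⟨α, β, hαβ, hsub, hsup⟩ := hV.exists_Ioo_subset_subset_Icc hVne
    (bddBelow_Ioc.mono inter_subset_right) (bddAbove_Ioc.mono inter_subset_right)
  have hlen : β - α ≤ arcLength.real J := by
    rw [Measure.real, arcLength_eq_map_restrict_Ioc a, Measure.map_apply hexp hJo.measurableSet,
      Measure.restrict_apply (hexp hJo.measurableSet)]
    have hfin : volume V ≠ ⊤ :=
      measure_ne_top_of_subset inter_subset_right measure_Ioc_lt_top.ne
    have := ENNReal.toReal_mono hfin (measure_mono hsub)
    rwa [Real.volume_Ioo, ENNReal.toReal_ofReal (by linarith)] at this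
  have hdisj : Disjoint E (Circle.exp '' Ioo α β) := by
    rw [disjoint_right]
    rintro _ ⟨t, ht, rfl⟩ hmem
    exact hJE (hsub ht).1 hmem
  have hmeas : Measurable fun ξ : Circle => infEDist ξ E ^ (-q) :=
    measurable_infEDist.pow_const _
  calc ∫⁻ ξ in J, infEDist ξ E ^ (-q) ∂arcLength
      = ∫⁻ t in V, infEDist (Circle.exp t) E ^ (-q) := by
        rw [arcLength_eq_map_restrict_Ioc a, setLIntegral_map hJo.measurableSet hmeas hexp,
          Measure.restrict_restrict (hexp hJo.measurableSet)]
    _ ≤ ∫⁻ t in Icc α β, infEDist (Circle.exp t) E ^ (-q) := lintegral_mono_set hsup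
    _ = ∫⁻ t in Ioo α β, infEDist (Circle.exp t) E ^ (-q) := by
        rw [restrict_Ioo_eq_restrict_Icc]
    _ ≤ ENNReal.ofReal (arcConst q * (β - α) ^ (1 - q)) :=
        lintegral_infEDist_rpow_le hq0 hq1 hαβ hdisj
    _ ≤ _ := by
        refine ENNReal.ofReal_le_ofReal (mul_le_mul_of_nonneg_left ?_ (arcConst_nonneg hq1))
        exact Real.rpow_le_rpow (by linarith) hlen (by linarith)

/-- The Beurling–Carleson condition makes `d(ξ, E) ^ (-q)` integrable. -/
lemma IsBeurlingCarleson.lintegral_infEDist_lt_top {q : ℝ} (hq0 : 0 < q) (hq1 : q < 1)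
    {E : Set Circle} (hE : IsBeurlingCarleson (1 - q) E) (hne : E.Nonempty) :
    ∫⁻ ξ, infEDist ξ E ^ (-q) ∂arcLength < ⊤ := by
  have hcount : Countable (complementaryArcs E) :=
    (countable_complementaryArcs hE.isClosed).to_subtype
  have hcover : Eᶜ ⊆ ⋃ J : complementaryArcs E, (J : Set Circle) := fun x hx =>
    mem_iUnion.2 ⟨⟨_, x, hx, rfl⟩, mem_connectedComponentIn hx⟩
  have hrestrict : arcLength.restrict Eᶜ = arcLength :=
    Measure.restrict_eq_self_of_ae_mem (show arcLength Eᶜᶜ = 0 by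
      rw [compl_compl]; exact hE.length_eq_zero)
  calc ∫⁻ ξ, infEDist ξ E ^ (-q) ∂arcLength
      = ∫⁻ ξ in Eᶜ, infEDist ξ E ^ (-q) ∂arcLength := by rw [hrestrict]
    _ ≤ ∫⁻ ξ in ⋃ J : complementaryArcs E, (J : Set Circle), infEDist ξ E ^ (-q) ∂arcLength :=
        lintegral_mono_set hcover
    _ ≤ ∑' J : complementaryArcs E, ∫⁻ ξ in (J : Set Circle), infEDist ξ E ^ (-q) ∂arcLength :=
        lintegral_iUnion_le _ _
    _ ≤ ∑' J : complementaryArcs E,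
          ENNReal.ofReal (arcConst q * arcLength.real (J : Set Circle) ^ (1 - q)) :=
        ENNReal.tsum_le_tsum fun J =>
          setLIntegral_infEDist_complementaryArc_le hq0 hq1 hE.isClosed hne J.2
    _ = ENNReal.ofReal (∑' J : complementaryArcs E,
          arcConst q * arcLength.real (J : Set Circle) ^ (1 - q)) := by
        refine (ENNReal.ofReal_tsum_of_nonneg (fun J => ?_) (hE.summable.mul_left _)).symm
        exact mul_nonneg (arcConst_nonneg hq1) (Real.rpow_nonneg measureReal_nonneg _)
    _ < ⊤ := ENNReal.ofReal_lt_top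

lemma IsBeurlingCarleson.mono {α β : ℝ} (hβ : 0 < β) (hαβ : α ≤ β) {E : Set Circle}
    (hE : IsBeurlingCarleson α E) : IsBeurlingCarleson β E := by
  refine ⟨hE.isClosed, hE.length_eq_zero, ?_⟩
  refine Summable.of_nonneg_of_le (fun J => Real.rpow_nonneg measureReal_nonneg _) (fun J => ?_)
    (hE.summable.mul_left (arcLength.real univ ^ (β - α)))
  have h0 : (0 : ℝ) ≤ arcLength.real (J : Set Circle) := measureReal_nonneg
  rcases h0.eq_or_lt with h | h
  · rw [← h, Real.zero_rpow hβ.ne']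
    exact mul_nonneg (Real.rpow_nonneg measureReal_nonneg _) (Real.rpow_nonneg le_rfl _)
  · calc arcLength.real (J : Set Circle) ^ β
        = arcLength.real (J : Set Circle) ^ (β - α) * arcLength.real (J : Set Circle) ^ α := by
          rw [← Real.rpow_add h, sub_add_cancel]
      _ ≤ _ := mul_le_mul_of_nonneg_right
          (Real.rpow_le_rpow h0 (measureReal_mono (subset_univ _)) (sub_nonneg.2 hαβ))
          (Real.rpow_nonneg h0 _)

/-! ### Integrability of the boundary derivative -/

/-- Weighting by a power `u > 1` of the distance to `E` makes `∫ dμ(ζ) / |ζ - ξ|²` integrable,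
because `d(ξ, E) ≤ |ξ - ζ|` for `ζ ∈ E` and `|ξ - ζ| ^ (u - 2)` is integrable. -/
lemma lintegral_inverseSquareIntegral_mul_lt_top {u : ℝ} (hu1 : 1 < u) (hu2 : u < 2)
    {E : Set Circle} (μ : Measure Circle) [IsFiniteMeasure μ] (hμ : μ Eᶜ = 0) :
    ∫⁻ ξ, inverseSquareIntegral μ ξ * infEDist ξ E ^ u ∂arcLength < ⊤ := by
  have hpt : ∀ ξ, inverseSquareIntegral μ ξ * infEDist ξ E ^ u ≤
      ∫⁻ ζ, edist ξ ζ ^ (-(2 - u)) ∂μ := by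
    intro ξ
    rw [inverseSquareIntegral, ← lintegral_mul_const _ (by fun_prop)]
    refine lintegral_mono_ae ?_
    filter_upwards [show ∀ᵐ ζ ∂μ, ζ ∈ E from hμ] with ζ hζ
    have hle : infEDist ξ E ≤ edist ξ ζ := infEDist_le_edist_of_mem hζ
    rcases eq_or_ne ξ ζ with rfl | hne
    · rw [edist_self] at hle
      simp [le_antisymm hle zero_le, ENNReal.zero_rpow_of_pos (by linarith : 0 < u)]
    · calc (edist ξ ζ ^ 2)⁻¹ * infEDist ξ E ^ u ≤ (edist ξ ζ ^ 2)⁻¹ * edist ξ ζ ^ u := by gcongr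
        _ = edist ξ ζ ^ (-(2 - u)) := by
          rw [← ENNReal.rpow_natCast, ← ENNReal.rpow_neg,
            ← ENNReal.rpow_add _ _ (edist_pos.2 hne).ne' (edist_ne_top _ _)]
          congr 1
          push_cast
          ring
  have hmeas : Measurable fun x : Circle × Circle => edist x.1 x.2 ^ (-(2 - u)) :=
    (measurable_fst.edist measurable_snd).pow_const _
  calc ∫⁻ ξ, inverseSquareIntegral μ ξ * infEDist ξ E ^ u ∂arcLength
      ≤ ∫⁻ ξ, ∫⁻ ζ, edist ξ ζ ^ (-(2 - u)) ∂μ ∂arcLength := lintegral_mono hpt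
    _ = ∫⁻ ζ, ∫⁻ ξ, edist ξ ζ ^ (-(2 - u)) ∂arcLength ∂μ :=
        lintegral_lintegral_swap hmeas.aemeasurable
    _ ≤ ∫⁻ _, ENNReal.ofReal (arcConst (2 - u) * (2 * Real.pi) ^ (1 - (2 - u))) ∂μ :=
        lintegral_mono fun ζ => lintegral_edist_rpow_le (by linarith) (by linarith) ζ
    _ < ⊤ := by
        rw [lintegral_const]
        exact ENNReal.mul_lt_top ENNReal.ofReal_lt_top (measure_lt_top _ _)

/-- Hölder's inequality with exponents `1 / p` and `1 / (1 - p)`, applied to the product of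
`(F d(·, E) ^ u) ^ p` and `d(·, E) ^ (-p u)`, where `F` is the inverse square integral and
`p u = q (1 - p)`. -/
lemma lintegral_inverseSquareIntegral_rpow_lt_top {p q : ℝ} (hp0 : 0 < p) (hp1 : p < 1)
    (hq0 : p / (1 - p) < q) (hq1 : q < 1) (hq2 : q < 2 * (p / (1 - p)))
    {E : Set Circle} (hE : IsBeurlingCarleson (1 - q) E) (hne : E.Nonempty)
    (μ : Measure Circle) [IsFiniteMeasure μ] (hμ : μ Eᶜ = 0) :
    ∫⁻ ξ, inverseSquareIntegral μ ξ ^ p ∂arcLength < ⊤ := by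
  have h1p : 0 < 1 - p := by linarith
  have hq : 0 < q := (div_pos hp0 h1p).trans hq0
  set u : ℝ := q * (1 - p) / p with hu
  have hu1 : 1 < u := by
    rw [hu, lt_div_iff₀ hp0]; rw [div_lt_iff₀ h1p] at hq0; linarith
  have hu2 : u < 2 := by
    rw [hu, div_lt_iff₀ hp0]
    rw [← mul_div_assoc, lt_div_iff₀ h1p] at hq2
    linarith
  have hup : u * p = q * (1 - p) := by rw [hu]; field_simp
  have hF := measurable_inverseSquareIntegral μ
  have hδ : Measurable fun ξ : Circle => infEDist ξ E := measurable_infEDist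
  set f : Circle → ℝ≥0∞ := fun ξ => (inverseSquareIntegral μ ξ * infEDist ξ E ^ u) ^ p with hf
  set g : Circle → ℝ≥0∞ := fun ξ => infEDist ξ E ^ (-(q * (1 - p))) with hg
  have hfg : ∀ᵐ ξ ∂arcLength, inverseSquareIntegral μ ξ ^ p = (f * g) ξ := by
    have hE0 : ∀ᵐ ξ ∂arcLength, ξ ∉ E := measure_eq_zero_iff_ae_notMem.1 hE.length_eq_zero
    filter_upwards [hE0] with ξ hξ
    have h0 : infEDist ξ E ≠ 0 := fun h =>
      hξ ((mem_iff_infEDist_zero_of_closed hE.isClosed).2 h)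
    have htop : infEDist ξ E ≠ ⊤ := infEDist_ne_top hne
    simp only [hf, hg, Pi.mul_apply]
    rw [ENNReal.mul_rpow_of_nonneg _ _ hp0.le, ← ENNReal.rpow_mul, hup, mul_assoc,
      ← ENNReal.rpow_add _ _ h0 htop, add_neg_cancel, ENNReal.rpow_zero, mul_one]
  have hconj : (1 / p).HolderConjugate (1 / (1 - p)) := by
    rw [Real.holderConjugate_iff]
    refine ⟨by rw [lt_div_iff₀ hp0]; linarith, ?_⟩
    simp
  rw [lintegral_congr_ae hfg]
  refine (ENNReal.lintegral_mul_le_Lp_mul_Lq _ hconj ?_ ?_).trans_lt ?_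
  · exact ((hF.mul (hδ.pow_const _)).pow_const _).aemeasurable
  · exact (hδ.pow_const _).aemeasurable
  have hf1 : ∀ ξ, f ξ ^ (1 / p) = inverseSquareIntegral μ ξ * infEDist ξ E ^ u := fun ξ => by
    rw [hf, ← ENNReal.rpow_mul, mul_one_div_cancel hp0.ne', ENNReal.rpow_one]
  have hg1 : ∀ ξ, g ξ ^ (1 / (1 - p)) = infEDist ξ E ^ (-q) := fun ξ => by
    rw [hg, ← ENNReal.rpow_mul]
    congr 1
    field_simp
  simp_rw [hf1, hg1]
  refine ENNReal.mul_lt_top (ENNReal.rpow_lt_top_of_nonneg (by positivity) ?_)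
    (ENNReal.rpow_lt_top_of_nonneg (by positivity) ?_)
  · exact (lintegral_inverseSquareIntegral_mul_lt_top hu1 hu2 μ hμ).ne
  · exact (hE.lintegral_infEDist_lt_top hq hq1 hne).ne

lemma circleAverage_eq_integral_exp (f : ℂ → ℝ) (r : ℝ) :
    Real.circleAverage f 0 r =
      (2 * Real.pi)⁻¹ * ∫ t in Ioc 0 (2 * Real.pi), f (r * Circle.exp t) := by
  rw [Real.circleAverage_def, intervalIntegral.integral_of_le Real.two_pi_pos.le, smul_eq_mul]
  simp [circleMap, Circle.coe_exp]

lemma memHardy_deriv_singularInner_of_lintegral_lt_top {p : ℝ} (hp0 : 0 < p)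
    (μ : Measure Circle) [IsFiniteMeasure μ]
    (h : ∫⁻ ξ, inverseSquareIntegral μ ξ ^ p ∂arcLength < ⊤) :
    MemHardy p (deriv (singularInner μ)) := by
  refine ⟨differentiableOn_deriv_singularInner μ,
    (2 * Real.pi)⁻¹ * (∫⁻ ξ, (8 * inverseSquareIntegral μ ξ) ^ p ∂arcLength).toReal,
    fun r hr => ?_⟩
  have hmeas : Measurable fun ξ => (8 * inverseSquareIntegral μ ξ) ^ p :=
    ((measurable_inverseSquareIntegral μ).const_mul 8).pow_const p
  have hfin : ∫⁻ ξ, (8 * inverseSquareIntegral μ ξ) ^ p ∂arcLength ≠ ⊤ := by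
    simp_rw [ENNReal.mul_rpow_of_nonneg _ _ hp0.le]
    rw [lintegral_const_mul' _ _ (ENNReal.rpow_ne_top_of_nonneg hp0.le (by simp))]
    exact ENNReal.mul_ne_top (ENNReal.rpow_ne_top_of_nonneg hp0.le (by simp)) h.ne
  rw [circleAverage_eq_integral_exp]
  refine mul_le_mul_of_nonneg_left ?_ (by positivity)
  refine (le_abs_self _).trans ?_
  rw [← Real.norm_eq_abs, ← toReal_enorm]
  refine ENNReal.toReal_mono hfin ((enorm_integral_le_lintegral_enorm _).trans ?_)
  rw [lintegral_arcLength 0 hmeas, zero_add]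
  refine lintegral_mono fun t => ?_
  rw [← ofReal_norm, Real.norm_of_nonneg (by positivity),
    ← ENNReal.ofReal_rpow_of_nonneg (norm_nonneg _) hp0.le, ofReal_norm]
  exact ENNReal.rpow_le_rpow (enorm_deriv_singularInner_le μ hr.1 hr.2 _) hp0.le

theorem memHardy_deriv_singularInner_of_isBeurlingCarleson {p q : ℝ} (hp0 : 0 < p)
    (hp : p < 1 / 2) (hq : p / (1 - p) < q) {E : Set Circle} (hE : IsBeurlingCarleson (1 - q) E)
    (μ : Measure Circle) [IsFiniteMeasure μ] (hμ : μ Eᶜ = 0) :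
    MemHardy p (deriv (singularInner μ)) := by
  refine memHardy_deriv_singularInner_of_lintegral_lt_top hp0 μ ?_
  rcases E.eq_empty_or_nonempty with rfl | hne
  · have hμ0 : μ = 0 := Measure.measure_univ_eq_zero.1 (by rwa [compl_empty] at hμ)
    simp [inverseSquareIntegral, hμ0, ENNReal.zero_rpow_of_pos hp0]
  have h1p : 0 < 1 - p := by linarith
  have hpos : 0 < p / (1 - p) := div_pos hp0 h1p
  have hlt1 : p / (1 - p) < 1 := by rw [div_lt_one h1p]; linarith
  -- The exponent may be lowered, since the arcs are bounded.
  obtain ⟨q', h1, h2⟩ := exists_between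
    (lt_min hq (lt_min hlt1 (by linarith : p / (1 - p) < 2 * (p / (1 - p)))))
  obtain ⟨h3, h4, h5⟩ : q' < q ∧ q' < 1 ∧ q' < 2 * (p / (1 - p)) := by
    simpa only [lt_min_iff] using h2
  exact lintegral_inverseSquareIntegral_rpow_lt_top hp0 (by linarith) h1 h4 h5
    (hE.mono (by linarith) (by linarith)) hne μ hμ

/-! ### Radial limits and Fatou's lemma -/

/-- By Fatou's lemma along radii, membership of `S_μ'` in `H^p` forces the boundary function
`|S_μ'|` to be in `L^p`. -/
lemma MemHardy.lintegral_inverseSquareIntegral_lt_top {p : ℝ} (hp0 : 0 < p) {μ : Measure Circle}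
    [IsFiniteMeasure μ] (h : MemHardy p (deriv (singularInner μ))) {E : Set Circle}
    (hE : IsClosed E) (hE0 : arcLength E = 0) (hμ : μ Eᶜ = 0) :
    ∫⁻ ξ, inverseSquareIntegral μ ξ ^ p ∂arcLength < ⊤ := by
  obtain ⟨hdiff, C, hC⟩ := h
  set D := deriv (singularInner μ)
  have hmeas : ∀ r : ℝ, Measurable fun ξ : Circle => ‖D (r * ξ)‖ₑ ^ p := fun r =>
    (((measurable_deriv _).comp (measurable_circle_coe.const_mul (r : ℂ))).enorm).pow_const p
  have hmean : ∀ r ∈ Ico (0 : ℝ) 1,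
      ∫⁻ ξ, ‖D (r * ξ)‖ₑ ^ p ∂arcLength ≤ ENNReal.ofReal (2 * Real.pi * C) := by
    intro r hr
    have hcont : Continuous fun t : ℝ => ‖D (r * Circle.exp t)‖ ^ p := by
      refine Continuous.rpow_const (Continuous.norm ?_) fun _ => Or.inr hp0.le
      refine hdiff.continuousOn.comp_continuous ?_ fun t => ?_
      · exact continuous_const.mul (continuous_subtype_val.comp Circle.exp.continuous)
      · simpa [Circle.norm_coe, abs_of_nonneg hr.1] using hr.2
    have hCr := hC r hr
    rw [circleAverage_eq_integral_exp, inv_mul_le_iff₀ Real.two_pi_pos] at hCr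
    rw [lintegral_arcLength 0 (hmeas r), zero_add]
    refine le_trans (le_of_eq ?_) (ENNReal.ofReal_le_ofReal hCr)
    rw [ofReal_integral_eq_lintegral_ofReal hcont.integrableOn_Ioc
      (.of_forall fun t => by positivity)]
    refine lintegral_congr fun t => ?_
    rw [← ENNReal.ofReal_rpow_of_nonneg (norm_nonneg _) hp0.le, ofReal_norm]
  set r : ℕ → ℝ := fun n => 1 - 1 / ((n : ℝ) + 1) with hr
  have hr_mem : ∀ n, r n ∈ Ico (0 : ℝ) 1 := fun n => by
    have h1 : 0 < 1 / ((n : ℝ) + 1) := by positivity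
    have h2 : 1 / ((n : ℝ) + 1) ≤ 1 := by
      rw [div_le_one (by positivity)]
      linarith [(Nat.cast_nonneg n : (0 : ℝ) ≤ n)]
    constructor <;> simp only [hr] <;> linarith
  have hr_lim : Tendsto r atTop (𝓝[<] 1) := by
    refine tendsto_nhdsWithin_iff.2 ⟨?_, .of_forall fun n => (hr_mem n).2⟩
    simpa [hr] using tendsto_one_div_add_atTop_nhds_zero_nat.const_sub (1 : ℝ)
  have hae : ∀ᵐ ξ ∂arcLength, inverseSquareIntegral μ ξ ^ p ≤
      liminf (fun n => ‖D (r n * ξ)‖ₑ ^ p) atTop := by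
    filter_upwards [measure_eq_zero_iff_ae_notMem.1 hE0] with ξ hξ
    have hlim := (((ENNReal.continuous_rpow_const (y := p)).tendsto _).comp
      ((tendsto_enorm_deriv_singularInner μ hE hμ hξ).comp hr_lim)).liminf_eq
    refine le_trans (ENNReal.rpow_le_rpow ?_ hp0.le) hlim.ge
    rw [two_mul]
    exact le_self_add
  calc ∫⁻ ξ, inverseSquareIntegral μ ξ ^ p ∂arcLength
      ≤ ∫⁻ ξ, liminf (fun n => ‖D (r n * ξ)‖ₑ ^ p) atTop ∂arcLength := lintegral_mono_ae hae
    _ ≤ liminf (fun n => ∫⁻ ξ, ‖D (r n * ξ)‖ₑ ^ p ∂arcLength) atTop :=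
        lintegral_liminf_le fun n => hmeas (r n)
    _ ≤ ENNReal.ofReal (2 * Real.pi * C) :=
        liminf_le_of_frequently_le' (.of_forall fun n => hmean _ (hr_mem n))
    _ < ⊤ := ENNReal.ofReal_lt_top

/-! ### Sets and measures defined by a jump function -/

section Gaps

variable {ι : Type*}

/-- The angle `-π + ∑_{d i < x} g i`: a left-continuous step function which jumps by `g i` at
`d i`. -/
noncomputable def gapCDF (d g : ι → ℝ) (x : ℝ) : ℝ :=
  -Real.pi + ∑' i, {i | d i < x}.indicator g i

/-- The open interval skipped by `gapCDF d g` at its jump at `d i`. -/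
noncomputable def gap (d g : ι → ℝ) (i : ι) : Set ℝ :=
  Ioo (gapCDF d g (d i)) (gapCDF d g (d i) + g i)

/-- The points of the circle whose angle is in no gap. -/
noncomputable def gapSet (d g : ι → ℝ) : Set Circle :=
  (⋃ i, Circle.exp '' gap d g i)ᶜ

/-- The image of Lebesgue measure on `(0, 1)` under `exp ∘ gapCDF d g`. -/
noncomputable def gapMeasure (d g : ι → ℝ) : Measure Circle :=
  (volume.restrict (Ioo (0 : ℝ) 1)).map fun x => Circle.exp (gapCDF d g x)

variable {d g : ι → ℝ}

lemma gapCDF_mono (hg : ∀ i, 0 ≤ g i) (hs : Summable g) : Monotone (gapCDF d g) := by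
  intro x y hxy
  refine add_le_add_right ((hs.indicator _).tsum_le_tsum (fun i => ?_) (hs.indicator _)) _
  exact indicator_le_indicator_of_subset (fun k hk => lt_of_lt_of_le hk hxy) hg i

lemma gapCDF_add_le (hg : ∀ i, 0 ≤ g i) (hs : Summable g) {i : ι} {x : ℝ} (hx : d i < x) :
    gapCDF d g (d i) + g i ≤ gapCDF d g x := by
  classical
  have h1 : HasSum (({i} : Set ι).indicator g) (g i) := by
    have := hasSum_single (f := ({i} : Set ι).indicator g) i fun k hk => by
      simp [hk]
    simpa using this
  rw [gapCDF, gapCDF, add_assoc, ← h1.tsum_eq, ← (hs.indicator _).tsum_add h1.summable]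
  refine add_le_add_right (((hs.indicator _).add h1.summable).tsum_le_tsum (fun k => ?_)
    (hs.indicator _)) _
  have hdisj : Disjoint {k | d k < d i} {i} := by simp
  refine (congrFun (Set.indicator_union_of_disjoint hdisj g) k).ge.trans
    (indicator_le_indicator_of_subset ?_ hg k)
  rintro k (hk | rfl)
  · exact lt_trans hk hx
  · exact hx

lemma neg_pi_le_gapCDF (hg : ∀ i, 0 ≤ g i) (x : ℝ) : -Real.pi ≤ gapCDF d g x :=
  le_add_of_nonneg_right (tsum_nonneg fun i => indicator_nonneg (fun k _ => hg k) i)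

lemma gapCDF_le_pi (hg : ∀ i, 0 ≤ g i) (hs : HasSum g (2 * Real.pi)) (x : ℝ) :
    gapCDF d g x ≤ Real.pi := by
  have := (hs.summable.indicator {i | d i < x}).tsum_le_tsum
    (fun i => indicator_le_self' (fun k _ => hg k) i) hs.summable
  rw [hs.tsum_eq] at this
  rw [gapCDF]
  linarith

lemma gap_subset_Ioo (hg : ∀ i, 0 ≤ g i) (hs : HasSum g (2 * Real.pi)) (i : ι) :
    gap d g i ⊆ Ioo (-Real.pi) Real.pi :=
  Ioo_subset_Ioo (neg_pi_le_gapCDF hg _)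
    ((gapCDF_add_le hg hs.summable (lt_add_one (d i))).trans (gapCDF_le_pi hg hs _))

lemma pairwise_disjoint_gap (hd : Function.Injective d) (hg : ∀ i, 0 ≤ g i) (hs : Summable g) :
    Pairwise (Function.onFun Disjoint (gap d g)) := by
  intro i k hik
  rcases (hd.ne hik).lt_or_gt with h | h
  · exact disjoint_left.2 fun t hi hk =>
      (hi.2.trans_le (gapCDF_add_le hg hs h)).not_gt hk.1
  · exact disjoint_left.2 fun t hi hk =>
      (hk.2.trans_le (gapCDF_add_le hg hs h)).not_gt hi.1

lemma isOpen_exp_gap (i : ι) : IsOpen (Circle.exp '' gap d g i) :=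
  isLocalHomeomorph_circleExp.isOpenMap _ isOpen_Ioo

lemma isClosed_gapSet : IsClosed (gapSet d g) :=
  (isOpen_iUnion fun i => isOpen_exp_gap i).isClosed_compl

lemma arcLength_exp_gap (hg : ∀ i, 0 ≤ g i) (hs : HasSum g (2 * Real.pi)) (i : ι) :
    arcLength (Circle.exp '' gap d g i) = ENNReal.ofReal (g i) := by
  have hexp : Measurable Circle.exp := Circle.exp.continuous.measurable
  have hm := (isOpen_exp_gap (d := d) (g := g) i).measurableSet
  have hsub : gap d g i ⊆ Ioc (-Real.pi) Real.pi :=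
    (gap_subset_Ioo hg hs i).trans Ioo_subset_Ioc_self
  have hinj : InjOn Circle.exp (Ioc (-Real.pi) Real.pi) :=
    Circle.exp_injOn_Ioc (by linarith)
  rw [arcLength, Measure.map_apply hexp hm, Measure.restrict_apply (hexp hm),
    hinj.preimage_image_inter hsub, gap, Real.volume_Ioo, add_sub_cancel_left]

lemma disjoint_exp_gap (hd : Function.Injective d) (hg : ∀ i, 0 ≤ g i)
    (hs : HasSum g (2 * Real.pi)) :
    Pairwise (Function.onFun Disjoint fun i => Circle.exp '' gap d g i) := by
  intro i k hik
  have hinj : InjOn Circle.exp (Ioc (-Real.pi) Real.pi) :=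
    Circle.exp_injOn_Ioc (by linarith)
  refine disjoint_left.2 ?_
  rintro _ ⟨t, ht, rfl⟩ ⟨s, hs', h⟩
  have hst : s = t := hinj (Ioo_subset_Ioc_self (gap_subset_Ioo hg hs k hs'))
    (Ioo_subset_Ioc_self (gap_subset_Ioo hg hs i ht)) h
  exact disjoint_left.1 (pairwise_disjoint_gap hd hg hs.summable hik) ht (hst ▸ hs')

lemma arcLength_univ : arcLength univ = ENNReal.ofReal (2 * Real.pi) := by
  rw [arcLength, Measure.map_apply Circle.exp.continuous.measurable .univ, preimage_univ,
    Measure.restrict_apply_univ, Real.volume_Ioc]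
  congr 1
  ring

lemma arcLength_gapSet [Countable ι] (hd : Function.Injective d) (hg : ∀ i, 0 ≤ g i)
    (hs : HasSum g (2 * Real.pi)) : arcLength (gapSet d g) = 0 := by
  rw [gapSet, measure_compl (MeasurableSet.iUnion fun i => (isOpen_exp_gap i).measurableSet)
    (measure_ne_top _ _), measure_iUnion (disjoint_exp_gap hd hg hs)
    fun i => (isOpen_exp_gap i).measurableSet, arcLength_univ]
  simp_rw [arcLength_exp_gap hg hs]
  rw [← ENNReal.ofReal_tsum_of_nonneg hg hs.summable, hs.tsum_eq, tsub_self]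

/-- Each complementary arc of `gapSet d g` is contained in the image of one gap, and different
arcs in different ones. -/
lemma isBeurlingCarleson_gapSet [Countable ι] (hd : Function.Injective d) (hg : ∀ i, 0 ≤ g i)
    (hs : HasSum g (2 * Real.pi)) {α : ℝ} (hα : 0 ≤ α) (hsα : Summable fun i => g i ^ α) :
    IsBeurlingCarleson α (gapSet d g) := by
  refine ⟨isClosed_gapSet, arcLength_gapSet hd hg hs, ?_⟩
  have key : ∀ J : complementaryArcs (gapSet d g), ∃ i,
      (J : Set Circle) = connectedComponentIn (gapSet d g)ᶜ
        (Circle.exp (gapCDF d g (d i) + g i / 2))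
      ∧ (J : Set Circle) ⊆ Circle.exp '' gap d g i := by
    rintro ⟨_, x, hx, rfl⟩
    have hU : (gapSet d g)ᶜ = ⋃ i, Circle.exp '' gap d g i := compl_compl _
    obtain ⟨i, hi⟩ := mem_iUnion.1 (hU ▸ hx)
    have hgap : IsPreconnected (Circle.exp '' gap d g i) :=
      isPreconnected_Ioo.image _ Circle.exp.continuous.continuousOn
    have hsub : Circle.exp '' gap d g i ⊆ (gapSet d g)ᶜ :=
      hU ▸ subset_iUnion (fun k => Circle.exp '' gap d g k) i
    have hmid : gapCDF d g (d i) + g i / 2 ∈ gap d g i := by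
      obtain ⟨t, ht, -⟩ := hi
      have := ht.1.trans ht.2
      constructor <;> linarith
    refine ⟨i, connectedComponentIn_eq
      (hgap.subset_connectedComponentIn hi hsub ⟨_, hmid, rfl⟩), ?_⟩
    -- The gap and the union of the other gaps separate the complement.
    refine isPreconnected_connectedComponentIn.subset_left_of_subset_union
      (v := ⋃ k ∈ {k | k ≠ i}, Circle.exp '' gap d g k) (isOpen_exp_gap i)
      (isOpen_biUnion fun k _ => isOpen_exp_gap k) ?_ ?_ ⟨x, mem_connectedComponentIn hx, hi⟩
    · exact disjoint_iUnion₂_right.2 fun k hk => disjoint_exp_gap hd hg hs (Ne.symm hk)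
    · refine (connectedComponentIn_subset _ _).trans (hU ▸ iUnion_subset fun k => ?_)
      by_cases hk : k = i
      · exact hk ▸ subset_union_left
      · exact (subset_biUnion_of_mem (u := fun k => Circle.exp '' gap d g k) hk).trans
          subset_union_right
  choose φ hφ1 hφ2 using key
  have hφinj : Function.Injective φ := fun J J' h =>
    Subtype.ext ((hφ1 J).trans (h ▸ (hφ1 J').symm))
  refine Summable.of_nonneg_of_le (fun J => Real.rpow_nonneg measureReal_nonneg _) (fun J => ?_)
    (hsα.comp_injective hφinj)
  refine Real.rpow_le_rpow measureReal_nonneg ?_ hα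
  have := measureReal_mono (μ := arcLength) (hφ2 J)
  rwa [Measure.real, Measure.real, arcLength_exp_gap hg hs, ENNReal.toReal_ofReal (hg _)] at this

lemma exp_gapCDF_mem_gapSet (hg : ∀ i, 0 ≤ g i) (hs : HasSum g (2 * Real.pi)) (x : ℝ) :
    Circle.exp (gapCDF d g x) ∈ gapSet d g := by
  rw [gapSet, mem_compl_iff, mem_iUnion]
  rintro ⟨i, t, ht, h⟩
  have h1 := gap_subset_Ioo hg hs i ht
  have h2 := neg_pi_le_gapCDF (d := d) hg x
  have h3 := gapCDF_le_pi (d := d) hg hs x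
  have heq : t = gapCDF d g x := by
    refine Circle.exp_injOn_of_forall_sub_mem_Ioo (s := {t, gapCDF d g x}) ?_ (by simp) (by simp) h
    have := h1.1
    have := h1.2
    rintro a (rfl | rfl) b (rfl | rfl) <;> constructor <;> linarith
  rw [heq] at ht
  rcases le_or_gt x (d i) with hx | hx
  · exact (gapCDF_mono hg hs.summable hx).not_gt ht.1
  · exact (gapCDF_add_le hg hs.summable hx).not_gt ht.2

lemma measurable_exp_gapCDF (hg : ∀ i, 0 ≤ g i) (hs : Summable g) :
    Measurable fun x => Circle.exp (gapCDF d g x) :=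
  Circle.exp.continuous.measurable.comp (gapCDF_mono hg hs).measurable

instance : IsFiniteMeasure (gapMeasure d g) := by
  unfold gapMeasure
  infer_instance

lemma gapMeasure_compl_gapSet (hg : ∀ i, 0 ≤ g i) (hs : HasSum g (2 * Real.pi)) :
    gapMeasure d g (gapSet d g)ᶜ = 0 := by
  rw [gapMeasure, Measure.map_apply (measurable_exp_gapCDF hg hs.summable)
    isClosed_gapSet.measurableSet.compl]
  convert measure_empty
  · ext x
    simpa using exp_gapCDF_mem_gapSet hg hs x
  · infer_instance

lemma edist_exp_le (s t : ℝ) : edist (Circle.exp s) (Circle.exp t) ≤ ENNReal.ofReal |s - t| := by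
  rw [edist_circle_eq]
  refine ENNReal.ofReal_le_ofReal ?_
  have h : (Circle.exp t : ℂ) - Circle.exp s =
      Circle.exp s * (Complex.exp (Complex.I * ((t - s : ℝ) : ℂ)) - 1) := by
    rw [mul_comm Complex.I, ← Circle.coe_exp, mul_sub, ← Circle.coe_mul, ← Circle.exp_add, mul_one,
      add_sub_cancel]
  rw [h, norm_mul, Circle.norm_coe, one_mul, abs_sub_comm]
  exact Real.norm_exp_I_mul_ofReal_sub_one_le

/-- On a gap, the inverse square integral is at least the mass carried by an interval `(a, d i)` of
parameters over the square of the distance to the far end of the gap. -/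
lemma le_inverseSquareIntegral_gapMeasure (hg : ∀ i, 0 ≤ g i) (hs : Summable g) {i : ι}
    {a ℓ : ℝ} (ha : 0 ≤ a) (hi : d i ≤ 1)
    (hℓ : ∀ x ∈ Ioo a (d i), gapCDF d g (d i) + g i - gapCDF d g x ≤ ℓ) {t : ℝ}
    (ht : t ∈ gap d g i) :
    (ENNReal.ofReal ℓ ^ 2)⁻¹ * ENNReal.ofReal (d i - a) ≤
      inverseSquareIntegral (gapMeasure d g) (Circle.exp t) := by
  have hm : Measurable fun ζ : Circle => (edist (Circle.exp t) ζ ^ 2)⁻¹ := by fun_prop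
  rw [inverseSquareIntegral, gapMeasure, lintegral_map hm (measurable_exp_gapCDF hg hs)]
  calc (ENNReal.ofReal ℓ ^ 2)⁻¹ * ENNReal.ofReal (d i - a)
      = ∫⁻ _ in Ioo a (d i), (ENNReal.ofReal ℓ ^ 2)⁻¹ := by
        rw [setLIntegral_const, Real.volume_Ioo]
    _ ≤ ∫⁻ x in Ioo a (d i), (edist (Circle.exp t) (Circle.exp (gapCDF d g x)) ^ 2)⁻¹ := by
        refine setLIntegral_mono' measurableSet_Ioo fun x hx => ?_
        refine ENNReal.inv_le_inv.2 (pow_le_pow_left' ((edist_exp_le _ _).trans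
          (ENNReal.ofReal_le_ofReal ?_)) 2)
        have h1 := gapCDF_mono (d := d) hg hs hx.2.le
        have h2 := hℓ x hx
        rw [abs_of_nonneg (by linarith [ht.1])]
        linarith [ht.2]
    _ ≤ _ := lintegral_mono_set (Ioo_subset_Ioo ha hi)

lemma tsum_le_lintegral_inverseSquareIntegral_gapMeasure [Countable ι]
    (hd : Function.Injective d) (hg : ∀ i, 0 ≤ g i) (hs : HasSum g (2 * Real.pi)) {p : ℝ}
    (hp : 0 ≤ p) {a ℓ : ι → ℝ} (ha : ∀ i, 0 ≤ a i) (hi : ∀ i, d i ≤ 1)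
    (hℓ : ∀ i, ∀ x ∈ Ioo (a i) (d i), gapCDF d g (d i) + g i - gapCDF d g x ≤ ℓ i) :
    ∑' i, ((ENNReal.ofReal (ℓ i) ^ 2)⁻¹ * ENNReal.ofReal (d i - a i)) ^ p * ENNReal.ofReal (g i) ≤
      ∫⁻ ξ, inverseSquareIntegral (gapMeasure d g) ξ ^ p ∂arcLength := by
  calc _ ≤ ∑' i, ∫⁻ ξ in Circle.exp '' gap d g i,
        inverseSquareIntegral (gapMeasure d g) ξ ^ p ∂arcLength := by
        refine ENNReal.tsum_le_tsum fun i => ?_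
        rw [← arcLength_exp_gap hg hs, ← setLIntegral_const]
        refine setLIntegral_mono' (isOpen_exp_gap i).measurableSet ?_
        rintro _ ⟨t, ht, rfl⟩
        exact ENNReal.rpow_le_rpow
          (le_inverseSquareIntegral_gapMeasure hg hs.summable (ha i) (hi i) (hℓ i) ht) hp
    _ = ∫⁻ ξ in ⋃ i, Circle.exp '' gap d g i,
        inverseSquareIntegral (gapMeasure d g) ξ ^ p ∂arcLength :=
        (lintegral_iUnion (fun i => (isOpen_exp_gap i).measurableSet)
          (disjoint_exp_gap hd hg hs) _).symm
    _ ≤ _ := setLIntegral_le_lintegral _ _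

end Gaps

/-! ### Dyadic midpoints -/

/-- The dyadic number `(2 j + 1) / 2 ^ (n + 1)`, the midpoint of the `j`-th dyadic interval of
generation `n`. -/
noncomputable def dyadicMidpoint (i : Σ n : ℕ, Fin (2 ^ n)) : ℝ :=
  (2 * (i.2 : ℕ) + 1 : ℝ) / 2 ^ (i.1 + 1)

lemma dyadicMidpoint_eq_iff_nat {n j m k : ℕ} :
    (2 * j + 1 : ℝ) / 2 ^ (n + 1) = (2 * k + 1 : ℝ) / 2 ^ (m + 1) ↔
      (2 * j + 1) * 2 ^ m = (2 * k + 1) * 2 ^ n := by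
  rw [div_eq_div_iff (by positivity) (by positivity), pow_succ, pow_succ, ← mul_assoc, ← mul_assoc,
    mul_left_inj' two_ne_zero]
  exact_mod_cast Iff.rfl

lemma odd_mul_two_pow_inj {a b m n : ℕ} (h : (2 * a + 1) * 2 ^ m = (2 * b + 1) * 2 ^ n) :
    m ≤ n := by
  by_contra! hlt
  obtain ⟨k, rfl⟩ := Nat.exists_eq_add_of_lt hlt
  rw [show n + k + 1 = (k + 1) + n by ring, pow_add, ← mul_assoc] at h
  have := Nat.eq_of_mul_eq_mul_right (by positivity) h
  rw [pow_succ] at this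
  have : (2 * a + 1) * (2 ^ k * 2) = 2 * ((2 * a + 1) * 2 ^ k) := by ring
  omega

lemma dyadicMidpoint_injective : Function.Injective dyadicMidpoint := by
  rintro ⟨n, j⟩ ⟨m, k⟩ h
  have h' := dyadicMidpoint_eq_iff_nat.1 h
  obtain rfl : n = m := le_antisymm (odd_mul_two_pow_inj h'.symm) (odd_mul_two_pow_inj h')
  have : 2 * (j : ℕ) + 1 = 2 * (k : ℕ) + 1 := Nat.eq_of_mul_eq_mul_right (by positivity) h'
  congr 1
  exact Fin.ext (by omega)

lemma dyadicMidpoint_le_one (i : Σ n : ℕ, Fin (2 ^ n)) : dyadicMidpoint i ≤ 1 := by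
  obtain ⟨n, j⟩ := i
  rw [dyadicMidpoint, div_le_one (by positivity)]
  have := j.2
  have h : 2 * (j : ℕ) + 1 ≤ 2 ^ (n + 1) := by rw [pow_succ]; omega
  exact_mod_cast h

/-- The dyadic midpoints inside the left half of a dyadic interval of generation `n` belong to later
generations `m`, and to its dyadic subintervals. -/
lemma dyadicMidpoint_mem_left_half {n m : ℕ} {j : Fin (2 ^ n)} {k : Fin (2 ^ m)}
    (h1 : (j : ℝ) / 2 ^ n < dyadicMidpoint ⟨m, k⟩)
    (h2 : dyadicMidpoint ⟨m, k⟩ < dyadicMidpoint ⟨n, j⟩) :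
    n < m ∧ (k : ℕ) ∈ Finset.Ico ((j : ℕ) * 2 ^ (m - n)) ((j + 1) * 2 ^ (m - n)) := by
  simp only [dyadicMidpoint] at h1 h2
  rw [div_lt_div_iff₀ (by positivity) (by positivity)] at h1 h2
  have h1' : (j : ℕ) * 2 ^ (m + 1) < (2 * (k : ℕ) + 1) * 2 ^ n := by exact_mod_cast h1
  have h2' : (2 * (k : ℕ) + 1) * 2 ^ (n + 1) < (2 * (j : ℕ) + 1) * 2 ^ (m + 1) := by
    exact_mod_cast h2
  have hnm : n < m := by
    by_contra! hle
    obtain ⟨l, rfl⟩ := Nat.exists_eq_add_of_le hle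
    have e1 : (2 * (k : ℕ) + 1) * 2 ^ (m + l) = ((2 * (k : ℕ) + 1) * 2 ^ l) * 2 ^ m := by ring
    have e2 : (2 * (k : ℕ) + 1) * 2 ^ (m + l + 1) =
        ((2 * (k : ℕ) + 1) * 2 ^ l) * 2 ^ (m + 1) := by ring
    have e3 : (j : ℕ) * 2 ^ (m + 1) = (2 * j) * 2 ^ m := by ring
    rw [e1, e3] at h1'
    rw [e2] at h2'
    have := Nat.lt_of_mul_lt_mul_right h1'
    have := Nat.lt_of_mul_lt_mul_right h2'
    omega
  refine ⟨hnm, ?_⟩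
  obtain ⟨l, rfl⟩ := Nat.exists_eq_add_of_lt hnm
  rw [show n + l + 1 - n = l + 1 by omega, Finset.mem_Ico]
  have e1 : (j : ℕ) * 2 ^ (n + l + 1 + 1) = (2 * (j * 2 ^ (l + 1))) * 2 ^ n := by ring
  have e2 : (2 * (j : ℕ) + 1) * 2 ^ (n + l + 1 + 1) =
      ((2 * j + 1) * 2 ^ (l + 1)) * 2 ^ (n + 1) := by
    ring
  rw [e1] at h1'
  rw [e2] at h2'
  have h3 := Nat.lt_of_mul_lt_mul_right h1'
  have h4 := Nat.lt_of_mul_lt_mul_right h2'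
  have h5 : (2 * (j : ℕ) + 1) * 2 ^ (l + 1) ≤ 2 * ((j + 1) * 2 ^ (l + 1)) := by
    nlinarith [Nat.two_pow_pos (l + 1)]
  omega

lemma hasSum_dyadic {f : ℕ → ℝ} (hf : ∀ n, 0 ≤ f n) (hs : Summable fun n => 2 ^ n * f n) :
    HasSum (fun i : Σ n : ℕ, Fin (2 ^ n) => f i.1) (∑' n, 2 ^ n * f n) := by
  have h1 : ∀ n : ℕ, HasSum (fun _ : Fin (2 ^ n) => f n) (2 ^ n * f n) := fun n => by
    simpa using hasSum_fintype (fun _ : Fin (2 ^ n) => f n)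
  have h2 : Summable fun i : Σ n : ℕ, Fin (2 ^ n) => f i.1 := by
    refine (summable_sigma_of_nonneg fun i => hf i.1).2 ⟨fun n => (h1 n).summable, ?_⟩
    simpa only [(h1 _).tsum_eq] using hs
  have h3 := h2.hasSum.sigma h1
  rw [h3.tsum_eq]
  exact h2.hasSum

/-- If the jumps `f n` of generation `n` decay geometrically faster than `2 ^ (-n)`, the jumps
inside the left half of a dyadic interval of generation `n` have a total size `O(f n)`. -/
lemma gapCDF_dyadic_sub_le {f : ℕ → ℝ} (hf : ∀ n, 0 ≤ f n) (hs : Summable fun n => 2 ^ n * f n)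
    {ρ : ℝ} (hρ0 : 0 ≤ ρ) (hρ1 : ρ < 1) (hfρ : ∀ n k, 2 ^ k * f (n + k) ≤ f n * ρ ^ k)
    (n : ℕ) (j : Fin (2 ^ n)) {x : ℝ} (hx : x ∈ Ioo ((j : ℝ) / 2 ^ n) (dyadicMidpoint ⟨n, j⟩)) :
    gapCDF dyadicMidpoint (fun i => f i.1) (dyadicMidpoint ⟨n, j⟩) -
      gapCDF dyadicMidpoint (fun i => f i.1) x ≤ f n * (1 - ρ)⁻¹ := by
  set d := dyadicMidpoint
  set g : (Σ n : ℕ, Fin (2 ^ n)) → ℝ := fun i => f i.1 with hg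
  have hgs : Summable g := (hasSum_dyadic hf hs).summable
  -- `h` keeps the jumps of later generations in the dyadic subintervals of the `j`-th interval.
  set h : (Σ n : ℕ, Fin (2 ^ n)) → ℝ := fun i =>
    if n < i.1 ∧ (i.2 : ℕ) ∈ Finset.Ico ((j : ℕ) * 2 ^ (i.1 - n)) ((j + 1) * 2 ^ (i.1 - n)) then
      f i.1 else 0 with hh
  have hh0 : ∀ i, 0 ≤ h i := fun i => by
    simp only [hh]; split_ifs <;> simp [hf]
  have hhs : Summable h := hgs.of_nonneg_of_le hh0 fun i => by
    simp only [hh, hg]; split_ifs <;> simp [hf]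
  have h1 : gapCDF d g (d ⟨n, j⟩) - gapCDF d g x ≤ ∑' i, h i := by
    rw [gapCDF, gapCDF, add_sub_add_left_eq_sub, ← (hgs.indicator _).tsum_sub (hgs.indicator _)]
    refine ((hgs.indicator _).sub (hgs.indicator _)).tsum_le_tsum (fun i => ?_) hhs
    obtain ⟨m, k⟩ := i
    by_cases ha : d ⟨m, k⟩ < d ⟨n, j⟩
    · by_cases hb : d ⟨m, k⟩ < x
      · simpa [indicator, ha, hb] using hh0 _
      · have := dyadicMidpoint_mem_left_half (hx.1.trans_le (not_lt.1 hb)) ha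
        simp only [indicator, mem_ofPred_eq, ha, hb, if_true, if_false, sub_zero, hh, hg]
        rw [if_pos this]
    · have hb : ¬ d ⟨m, k⟩ < x := fun hb => ha (hb.trans hx.2)
      simpa [indicator, ha, hb] using hh0 _
  have h2 : ∀ m, ∑' k, h ⟨m, k⟩ ≤ if n < m then 2 ^ (m - n) * f m else 0 := by
    intro m
    rw [tsum_fintype]
    split_ifs with hm
    · simp only [hh, hm, true_and]
      rw [← Finset.sum_filter, Finset.sum_const, nsmul_eq_mul]
      refine mul_le_mul_of_nonneg_right ?_ (hf m)
      have hcard := Finset.card_le_card_of_injOn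
        (s := Finset.univ.filter fun k : Fin (2 ^ m) =>
          (k : ℕ) ∈ Finset.Ico ((j : ℕ) * 2 ^ (m - n)) ((j + 1) * 2 ^ (m - n)))
        (t := Finset.Ico ((j : ℕ) * 2 ^ (m - n)) ((j + 1) * 2 ^ (m - n)))
        (fun k : Fin (2 ^ m) => (k : ℕ)) (fun k hk => (Finset.mem_filter.1 hk).2)
        (fun _ _ _ _ h => Fin.ext h)
      rw [Nat.card_Ico, ← Nat.sub_mul, Nat.add_sub_cancel_left, one_mul] at hcard
      exact_mod_cast hcard
    · simp [hh, hm]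
  have h3 : HasSum (fun k : ℕ => f n * ρ ^ k) (f n * (1 - ρ)⁻¹) :=
    (hasSum_geometric_of_lt_one hρ0 hρ1).mul_left _
  -- Reindex the generations `m ≥ n` as `m = n + k`.
  have h4 : HasSum (fun m : ℕ => if n ≤ m then f n * ρ ^ (m - n) else 0) (f n * (1 - ρ)⁻¹) := by
    rw [← (add_left_injective n).hasSum_iff]
    · simpa [Function.comp_def] using h3
    · intro m hm
      rw [if_neg]
      intro hnm
      exact hm ⟨m - n, Nat.sub_add_cancel hnm⟩
  calc gapCDF d g (d ⟨n, j⟩) - gapCDF d g x ≤ ∑' i, h i := h1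
    _ = ∑' m, ∑' k, h ⟨m, k⟩ := hhs.tsum_sigma
    _ ≤ ∑' m : ℕ, if n ≤ m then f n * ρ ^ (m - n) else 0 := by
        refine hhs.sigma.tsum_le_tsum (fun m => (h2 m).trans ?_) h4.summable
        split_ifs with hm hm' hm'
        · have := hfρ n (m - n)
          rwa [Nat.add_sub_cancel' hm'] at this
        · exact absurd hm.le hm'
        · exact mul_nonneg (hf n) (pow_nonneg hρ0 _)
        · exact le_rfl
    _ = _ := h4.tsum_eq

/-! ### The extremal gap lengths -/

/-- The unnormalised gap length `2 ^ (-n β) (n + 1) ^ (-γ)` of generation `n`, where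
`β = (1 - p) / (1 - 2 p)` and `γ = 1 / (1 - 2 p)`. -/
noncomputable def gapWeight (p : ℝ) (n : ℕ) : ℝ :=
  ((2 : ℝ) ^ n) ^ (-((1 - p) / (1 - 2 * p))) * ((n : ℝ) + 1) ^ (-(1 / (1 - 2 * p)))

/-- The ratio of the geometric series that bounds the total length of the gaps inside a dyadic
interval. -/
noncomputable def gapRatio (p : ℝ) : ℝ := 2 ^ (1 - (1 - p) / (1 - 2 * p))

lemma gapWeight_pos (p : ℝ) (n : ℕ) : 0 < gapWeight p n := by
  unfold gapWeight; positivity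

lemma gapRatio_nonneg (p : ℝ) : 0 ≤ gapRatio p := by
  unfold gapRatio; positivity

lemma gapRatio_lt_one {p : ℝ} (hp0 : 0 < p) (hp : p < 1 / 2) : gapRatio p < 1 := by
  refine Real.rpow_lt_one_of_one_lt_of_neg one_lt_two ?_
  have : 1 < (1 - p) / (1 - 2 * p) := by rw [lt_div_iff₀] <;> linarith
  linarith

lemma two_pow_mul_gapWeight_add_le {p : ℝ} (hp : p < 1 / 2) (n k : ℕ) :
    2 ^ k * gapWeight p (n + k) ≤ gapWeight p n * gapRatio p ^ k := by
  have h12 : 0 < 1 - 2 * p := by linarith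
  have h1 : gapRatio p ^ k = 2 ^ k * ((2 : ℝ) ^ k) ^ (-((1 - p) / (1 - 2 * p))) := by
    rw [gapRatio, ← Real.rpow_natCast, ← Real.rpow_mul zero_le_two, mul_comm,
      Real.rpow_mul zero_le_two, Real.rpow_natCast, sub_eq_add_neg,
      Real.rpow_add (by positivity), Real.rpow_one]
  have h2 : ((n + k : ℕ) + 1 : ℝ) ^ (-(1 / (1 - 2 * p))) ≤
      ((n : ℝ) + 1) ^ (-(1 / (1 - 2 * p))) := by
    refine Real.rpow_le_rpow_of_nonpos (by positivity) ?_ (neg_nonpos.2 (by positivity))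
    push_cast
    linarith [(Nat.cast_nonneg k : (0 : ℝ) ≤ k)]
  rw [h1, gapWeight, gapWeight, pow_add, Real.mul_rpow (by positivity) (by positivity)]
  calc _ = 2 ^ k * (((2 : ℝ) ^ n) ^ (-((1 - p) / (1 - 2 * p))) *
        ((2 : ℝ) ^ k) ^ (-((1 - p) / (1 - 2 * p)))) *
          ((n + k : ℕ) + 1 : ℝ) ^ (-(1 / (1 - 2 * p))) := by ring
    _ ≤ 2 ^ k * (((2 : ℝ) ^ n) ^ (-((1 - p) / (1 - 2 * p))) *
        ((2 : ℝ) ^ k) ^ (-((1 - p) / (1 - 2 * p)))) *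
          ((n : ℝ) + 1) ^ (-(1 / (1 - 2 * p))) := by gcongr
    _ = _ := by ring

lemma summable_two_pow_mul_gapWeight {p : ℝ} (hp0 : 0 < p) (hp : p < 1 / 2) :
    Summable fun n => 2 ^ n * gapWeight p n := by
  refine Summable.of_nonneg_of_le (fun n => by have := gapWeight_pos p n; positivity) (fun n => ?_)
    ((summable_geometric_of_lt_one (gapRatio_nonneg p) (gapRatio_lt_one hp0 hp)).mul_left
      (gapWeight p 0))
  simpa using two_pow_mul_gapWeight_add_le hp 0 n

lemma gapWeight_rpow (p : ℝ) (n : ℕ) (s : ℝ) : gapWeight p n ^ s =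
    ((2 : ℝ) ^ n) ^ (-((1 - p) / (1 - 2 * p)) * s) *
      ((n : ℝ) + 1) ^ (-(1 / (1 - 2 * p)) * s) := by
  rw [gapWeight, Real.mul_rpow (by positivity) (by positivity), ← Real.rpow_mul (by positivity),
    ← Real.rpow_mul (by positivity)]

lemma two_pow_mul_gapWeight_rpow {p : ℝ} (hp : p < 1 / 2) (n : ℕ) :
    2 ^ n * gapWeight p n ^ (1 - p / (1 - p)) = ((n : ℝ) + 1) ^ (-(1 / (1 - p))) := by
  have h12 : 1 - 2 * p ≠ 0 := by linarith
  have h1 : 1 - p ≠ 0 := by linarith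
  have e0 : 1 - p / (1 - p) = (1 - 2 * p) / (1 - p) := by field_simp; ring
  have e1 : -((1 - p) / (1 - 2 * p)) * (1 - p / (1 - p)) = -1 := by
    rw [e0, neg_mul, div_mul_div_cancel₀ h12, div_self h1]
  have e2 : -(1 / (1 - 2 * p)) * (1 - p / (1 - p)) = -(1 / (1 - p)) := by
    rw [e0, neg_mul, div_mul_div_cancel₀ h12]
  rw [gapWeight_rpow, e1, e2, Real.rpow_neg_one, mul_inv_cancel_left₀ (by positivity)]

/-- The critical exponents: the contribution of the `2 ^ n` gaps of generation `n` to
`∫ |S_μ'| ^ p` is comparable to `1 / (n + 1)`. -/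
lemma two_pow_mul_gap_contribution {p : ℝ} (hp : p < 1 / 2) {c M : ℝ} (hc : 0 < c) (hM : 0 < M)
    (n : ℕ) :
    2 ^ n * ((((c * gapWeight p n * M) ^ 2)⁻¹ * (1 / 2 ^ (n + 1))) ^ p * (c * gapWeight p n)) =
      ((M ^ 2)⁻¹ / 2) ^ p * c ^ (1 - 2 * p) * (1 / ((n : ℝ) + 1)) := by
  have h12 : 1 - 2 * p ≠ 0 := by linarith
  have hw := gapWeight_pos p n
  have hcw : 0 < c * gapWeight p n := mul_pos hc hw
  have e1 : -((1 - p) / (1 - 2 * p)) * (1 - 2 * p) = -1 + p := by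
    rw [neg_mul, div_mul_cancel₀ _ h12]; ring
  have e2 : -(1 / (1 - 2 * p)) * (1 - 2 * p) = -1 := by
    rw [neg_mul, div_mul_cancel₀ _ h12]
  have h1 : ((c * gapWeight p n * M) ^ 2)⁻¹ * (1 / 2 ^ (n + 1)) =
      ((M ^ 2)⁻¹ / 2) * ((c * gapWeight p n) ^ (-2 : ℝ) * ((2 : ℝ) ^ n)⁻¹) := by
    rw [Real.rpow_neg hcw.le, Real.rpow_two]
    field_simp
    ring
  have h2 : ((c * gapWeight p n) ^ (-2 : ℝ)) ^ p * (c * gapWeight p n) =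
      c ^ (1 - 2 * p) * (((2 : ℝ) ^ n)⁻¹ * ((2 : ℝ) ^ n) ^ p * ((n : ℝ) + 1)⁻¹) := by
    rw [← Real.rpow_mul hcw.le, ← Real.rpow_add_one hcw.ne',
      show -2 * p + 1 = 1 - 2 * p by ring, Real.mul_rpow hc.le hw.le, gapWeight_rpow, e1, e2,
      Real.rpow_add (by positivity), Real.rpow_neg_one, Real.rpow_neg_one]
  rw [h1, Real.mul_rpow (by positivity) (by positivity),
    Real.mul_rpow (by positivity) (by positivity), Real.inv_rpow (by positivity)]
  have hX : 0 < ((2 : ℝ) ^ n) ^ p := by positivity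
  calc _ = ((M ^ 2)⁻¹ / 2) ^ p * (2 ^ n * ((((2 : ℝ) ^ n) ^ p)⁻¹ *
        (((c * gapWeight p n) ^ (-2 : ℝ)) ^ p * (c * gapWeight p n)))) := by ring
    _ = _ := by
        rw [h2]
        field_simp

theorem exists_isBeurlingCarleson_not_memHardy {p : ℝ} (hp0 : 0 < p) (hp : p < 1 / 2) :
    ∃ E : Set Circle, IsBeurlingCarleson (1 - p / (1 - p)) E ∧
      ∃ μ : Measure Circle, IsFiniteMeasure μ ∧ μ Eᶜ = 0 ∧
        ¬ MemHardy p (deriv (singularInner μ)) := by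
  have h1p : 0 < 1 - p := by linarith
  have hws := summable_two_pow_mul_gapWeight hp0 hp
  have hw := gapWeight_pos p
  have hT : 0 < ∑' n, 2 ^ n * gapWeight p n :=
    hws.tsum_pos (fun n => by have := hw n; positivity) 0 (by have := hw 0; positivity)
  -- The normalisation makes the gaps fill the circle.
  set c : ℝ := 2 * Real.pi / ∑' n, 2 ^ n * gapWeight p n with hc
  have hc0 : 0 < c := div_pos Real.two_pi_pos hT
  set f : ℕ → ℝ := fun n => c * gapWeight p n with hf
  have hf0 : ∀ n, 0 < f n := fun n => mul_pos hc0 (hw n)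
  have hfeq : (fun n => 2 ^ n * f n) = fun n => c * (2 ^ n * gapWeight p n) := by
    funext n; simp only [hf]; ring
  have hfs : Summable fun n => 2 ^ n * f n := hfeq ▸ hws.mul_left c
  have hfsum : ∑' n, 2 ^ n * f n = 2 * Real.pi := by
    rw [hfeq, tsum_mul_left, hc, div_mul_cancel₀ _ hT.ne']
  set g : (Σ n : ℕ, Fin (2 ^ n)) → ℝ := fun i => f i.1 with hg
  have hg0 : ∀ i, 0 ≤ g i := fun i => (hf0 i.1).le
  have hgs : HasSum g (2 * Real.pi) := hfsum ▸ hasSum_dyadic (fun n => (hf0 n).le) hfs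
  have hfρ : ∀ n k, 2 ^ k * f (n + k) ≤ f n * gapRatio p ^ k := fun n k => by
    have := mul_le_mul_of_nonneg_left (two_pow_mul_gapWeight_add_le hp n k) hc0.le
    simp only [hf]
    linarith
  have hρ0 := gapRatio_nonneg p
  have hρ1 := gapRatio_lt_one hp0 hp
  have hM : 0 < 1 + (1 - gapRatio p)⁻¹ := by
    have : 0 < (1 - gapRatio p)⁻¹ := inv_pos.2 (by linarith)
    linarith
  set M := 1 + (1 - gapRatio p)⁻¹ with hMdef
  have hα : 0 ≤ 1 - p / (1 - p) := by
    rw [sub_nonneg, div_le_one h1p]; linarith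
  have hBC : IsBeurlingCarleson (1 - p / (1 - p)) (gapSet dyadicMidpoint g) := by
    refine isBeurlingCarleson_gapSet dyadicMidpoint_injective hg0 hgs hα ?_
    refine (hasSum_dyadic (f := fun n => f n ^ (1 - p / (1 - p)))
      (fun n => Real.rpow_nonneg (hf0 n).le _) ?_).summable
    have heq : (fun n : ℕ => 2 ^ n * f n ^ (1 - p / (1 - p))) =
        fun n : ℕ => c ^ (1 - p / (1 - p)) * ((n : ℝ) + 1) ^ (-(1 / (1 - p))) := by
      funext n
      rw [← two_pow_mul_gapWeight_rpow hp, hf, Real.mul_rpow hc0.le (hw n).le]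
      ring
    rw [heq]
    refine Summable.mul_left _ ?_
    have := (summable_nat_add_iff 1).2 (Real.summable_nat_rpow.2
      (neg_lt_neg ((one_lt_div h1p).2 (by linarith)) : -(1 / (1 - p)) < -1))
    simpa using this
  refine ⟨_, hBC, gapMeasure dyadicMidpoint g, inferInstance, gapMeasure_compl_gapSet hg0 hgs,
    fun hmem => ?_⟩
  have hlt := hmem.lintegral_inverseSquareIntegral_lt_top hp0 hBC.isClosed hBC.length_eq_zero
    (gapMeasure_compl_gapSet hg0 hgs)
  have hle := tsum_le_lintegral_inverseSquareIntegral_gapMeasure dyadicMidpoint_injective hg0 hgs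
    hp0.le (a := fun i => (i.2 : ℕ) / 2 ^ i.1) (ℓ := fun i => f i.1 * M)
    (fun i => by positivity) dyadicMidpoint_le_one (by
      rintro ⟨n, j⟩ x hx
      have := gapCDF_dyadic_sub_le (fun n => (hf0 n).le) hfs hρ0 hρ1 hfρ n j hx
      simp only [hMdef, hg, mul_add, mul_one]
      linarith)
  have hterm : ∀ i : Σ n : ℕ, Fin (2 ^ n), ((ENNReal.ofReal (f i.1 * M) ^ 2)⁻¹ *
      ENNReal.ofReal (dyadicMidpoint i - (i.2 : ℕ) / 2 ^ i.1)) ^ p * ENNReal.ofReal (g i) =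
        ENNReal.ofReal ((((f i.1 * M) ^ 2)⁻¹ * (1 / 2 ^ (i.1 + 1))) ^ p * f i.1) := by
    rintro ⟨n, j⟩
    have hfM : 0 < f n * M := mul_pos (hf0 n) hM
    have hd : dyadicMidpoint ⟨n, j⟩ - (j : ℕ) / 2 ^ n = 1 / 2 ^ (n + 1) := by
      rw [dyadicMidpoint, pow_succ]
      field_simp
      ring
    simp only [hd, hg]
    rw [← ENNReal.ofReal_pow hfM.le, ← ENNReal.ofReal_inv_of_pos (by positivity),
      ← ENNReal.ofReal_mul (by positivity), ENNReal.ofReal_rpow_of_nonneg (by positivity) hp0.le,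
      ← ENNReal.ofReal_mul (by positivity)]
  rw [tsum_congr hterm] at hle
  have hsummable : Summable fun i : Σ n : ℕ, Fin (2 ^ n) =>
      (((f i.1 * M) ^ 2)⁻¹ * (1 / 2 ^ (i.1 + 1))) ^ p * f i.1 := by
    have h0 : ∀ i : Σ n : ℕ, Fin (2 ^ n),
        0 ≤ (((f i.1 * M) ^ 2)⁻¹ * (1 / 2 ^ (i.1 + 1))) ^ p * f i.1 := fun i => by
      have := hf0 i.1
      positivity
    refine (ENNReal.summable_toReal (hle.trans_lt hlt).ne).congr fun i => ?_
    exact ENNReal.toReal_ofReal (h0 i)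
  have hsig := hsummable.sigma
  simp only [tsum_fintype, Finset.sum_const, Finset.card_univ, Fintype.card_fin, nsmul_eq_mul,
    Nat.cast_pow, Nat.cast_ofNat, hf, two_pow_mul_gap_contribution hp hc0 hM] at hsig
  have hK : ((M ^ 2)⁻¹ / 2) ^ p * c ^ (1 - 2 * p) ≠ 0 := by positivity
  rw [summable_mul_left_iff hK] at hsig
  refine Real.not_summable_one_div_natCast ((summable_nat_add_iff 1).1 ?_)
  simpa using hsig

theorem mainTheorem6 (p : ℝ) (hp0 : 0 < p) (hp : p < 1 / 2) :
    (∀ q : ℝ, p / (1 - p) < q → ∀ E : Set Circle, IsBeurlingCarleson (1 - q) E →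
      ∀ μ : Measure Circle, IsFiniteMeasure μ → μ Eᶜ = 0 →
        MemHardy p (deriv (singularInner μ))) ∧
    (∃ E : Set Circle, IsBeurlingCarleson (1 - p / (1 - p)) E ∧
      ∃ μ : Measure Circle, IsFiniteMeasure μ ∧ μ Eᶜ = 0 ∧
        ¬ MemHardy p (deriv (singularInner μ))) :=
  ⟨fun _ hq _ hE μ _ hμ => memHardy_deriv_singularInner_of_isBeurlingCarleson hp0 hp hq hE μ hμ,
    exists_isBeurlingCarleson_not_memHardy hp0 hp⟩
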